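/- Let the integers $v_0(n)$, $n \ge 0$, be defined by the formal power series identity $$\sum_{n=0}^\infty v_0(n)\, q^n \;=\; \sum_{k=0}^\infty \frac{q^{k^2}\,(-q;q^2)_k}{(q;q^2)_k},\qquad (a;q)_0 = 1,\quad (a;q)_k=\prod_{i=1}^{k}\left(1-aq^{i-1}\right)$$ (so that $\sum_{n\ge 0} v_0(n)q^n=\frac{V_0(q)+1}{2}$, where $V_0(q)$ is the eighth order mock theta function of Gordon and McIntosh). Then for all integers $n \ge 0$ and $\alpha \ge 0$: \begin{align*} v_0\!\left(2^{2\alpha+1}(2n+1)\right) &\equiv 0 \pmod{2^{3\alpha}},\\ v_0\!\left(2^{2\alpha+2}(4n+3)\right) &\equiv 0 \pmod{2^{3\alpha+4}},\\ v_0\!\left(2^{2\alpha+2}(8n+7)\right) &\equiv 0 \pmod{2^{3\alpha+6}},\\ v_0\!\left(2^{2\alpha+2}(8n+5)\right) &\equiv 0 \pmod{2^{3\alpha+6}}. \end{align*} -/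

import Mathlib

open PowerSeries

/-- The finite `q`-shifted factorial `(a; q)_n = ∏_{i=1}^{n} (1 - a q^{i-1})`, for formal power
series `a`, `q` with integer coefficients. -/
noncomputable def qPochhammer (a q : PowerSeries ℤ) (n : ℕ) : PowerSeries ℤ :=
  ∏ i ∈ Finset.range n, (1 - a * q ^ i)

theorem constantCoeff_qPochhammer_X (n : ℕ) :
    constantCoeff (qPochhammer (X : PowerSeries ℤ) (X ^ 2) n) = 1 := by
  simp [qPochhammer, map_prod]

/-- The `k`-th summand `q^{k^2} (-q; q^2)_k / (q; q^2)_k` as a formal power series in `q = X`.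
The denominator has constant coefficient `1`, so it is invertible over the integers. -/
noncomputable def v0Term (k : ℕ) : PowerSeries ℤ :=
  X ^ (k ^ 2) * qPochhammer (-X) (X ^ 2) k * invOfUnit (qPochhammer X (X ^ 2) k) 1

/-- `v0Term k` is the quotient it should be. -/
theorem v0Term_mul_denom (k : ℕ) :
    v0Term k * qPochhammer X (X ^ 2) k = X ^ (k ^ 2) * qPochhammer (-X) (X ^ 2) k := by
  have h : qPochhammer (X : PowerSeries ℤ) (X ^ 2) k *
      invOfUnit (qPochhammer X (X ^ 2) k) 1 = 1 :=
    mul_invOfUnit _ 1 (by rw [constantCoeff_qPochhammer_X]; rfl)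
  rw [v0Term, mul_assoc, mul_comm (invOfUnit _ _), h, mul_one]

/-- Only the summands with `k ≤ n` (even `k ^ 2 ≤ n`) contribute to the coefficient of `q^n`. -/
theorem coeff_v0Term_of_lt {n k : ℕ} (h : n < k) : coeff n (v0Term k) = 0 := by
  have h2 : n < k ^ 2 := by nlinarith
  rw [v0Term, mul_assoc, coeff_X_pow_mul', if_neg (not_le.mpr h2)]

/-- The partition function `v_0(n)`: the coefficient of `q^n` in
`∑_{k ≥ 0} q^{k^2} (-q; q^2)_k / (q; q^2)_k = (V_0(q) + 1) / 2`, where `V_0` is the eighth order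
mock theta function. Summands with `k > n` do not contribute to this coefficient. -/
noncomputable def v0 (n : ℕ) : ℤ :=
  ∑ k ∈ Finset.range (n + 1), coeff n (v0Term k)

open scoped PowerSeries.WithPiTopology in
/-- The series `∑_k v0Term k` converges (coefficientwise) to `∑_n v_0(n) q^n`. -/
theorem hasSum_v0Term : HasSum v0Term (PowerSeries.mk v0) := by
  rw [PowerSeries.WithPiTopology.hasSum_iff_hasSum_coeff]
  intro n
  rw [coeff_mk, v0]
  refine hasSum_sum_of_ne_finset_zero fun k hk => coeff_v0Term_of_lt ?_
  rw [Finset.mem_range] at hk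
  omega

/-! Let F be the generating function, V(q) = F(q) + F(-q) - 1 and φ(q) = ∑ q^{n²} over all integers
n. V is the value at x = 1 of a bilateral series in x, whose terms of negative index are those of
positive index with x replaced by -x. Telescoping gives a first-order equation relating x to q²x.
Iterating it towards x = 0 yields V(q) = φ(q²) ∏ (1 + q^{4i+2}) / (1 - q^{4i+2}). Gauss's product
for φ and φ(q) φ(-q) = φ(-q²)² turn this into V(q) φ(-q⁴) = φ(q²)² (`v0Even_mul`).

The values at 4^{k+1} m are read off from iterates of U₄, and U₄ V = φ(q)² / φ(-q). With τ as in
`tau`, φ(±q) = φ(q⁴)(1 ± 2τ), and τ⁴ is a series in q⁴ (`tau_pow_four`), while τ is supported on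
exponents 1 mod 4. So U₄ of a polynomial in τ over series in q⁴ sees only the powers τ^{4j}. Put W =
((φ(q)/φ(-q))⁴ - 1)/16 and let R be the ring generated by (φ(q)/φ(-q))^{±4}. Then U₄² V = φ + 64 φW,
U₄ φ = φ, and U₄ maps φW R into 8 φW R, since τ times a polynomial in 2τ contributes only through τ
(2τ)³ = 8 τ⁴. This gives the factor 8^k in `uFour_iterate_v0Even`.

The remaining powers of two come from reduction mod 16: elements of R become constants, φW becomes a
short polynomial in τ, and its terms live in known residue classes, where φ itself has no
coefficients. A single U₄ is handled separately by expanding (1 + 2τ)² / (1 - 2τ) mod 128. -/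

/-- The inverse of a power series with constant coefficient `1`. -/
noncomputable def unitInv (f : PowerSeries ℤ) : PowerSeries ℤ := invOfUnit f 1

theorem mul_unitInv {f : PowerSeries ℤ} (h : constantCoeff f = 1) : f * unitInv f = 1 :=
  mul_invOfUnit f 1 (by rw [h]; rfl)

theorem constantCoeff_one_sub_mul_X_pow_succ (x : PowerSeries ℤ) (n : ℕ) :
    constantCoeff (1 - x * X ^ (n + 1)) = 1 := by
  simp

/-- If all truncations of `f - g` vanish then `f = g`. -/
theorem eq_of_forall_X_pow_dvd_sub {f g : PowerSeries ℤ} (h : ∀ M : ℕ, X ^ M ∣ f - g) : f = g := by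
  ext n
  have := X_pow_dvd_iff.1 (h (n + 1)) n (by omega)
  rwa [map_sub, sub_eq_zero] at this

/-! ### A bilateral series with a parameter -/

/-- The summand `∏_{i<n} q^{2i+1} (x + q^{2i+1}) / (1 - x q^{2i+1})`. -/
noncomputable def mockTerm (x : PowerSeries ℤ) (n : ℕ) : PowerSeries ℤ :=
  ∏ i ∈ Finset.range n,
    (X ^ (2 * i + 1) * (x + X ^ (2 * i + 1)) * unitInv (1 - x * X ^ (2 * i + 1)))

theorem mockTerm_succ (x : PowerSeries ℤ) (n : ℕ) :
    mockTerm x (n + 1) = mockTerm x n *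
      (X ^ (2 * n + 1) * (x + X ^ (2 * n + 1)) * unitInv (1 - x * X ^ (2 * n + 1))) :=
  Finset.prod_range_succ _ _

theorem mockTerm_zero (x : PowerSeries ℤ) : mockTerm x 0 = 1 := Finset.prod_range_zero _

/-- Since q²x + q^{2i+1} = q²(x + q^{2i-1}), the numerators and denominators are those of the
unshifted product moved by one index, so only boundary factors remain. -/
theorem mockTerm_shift (x : PowerSeries ℤ) (n : ℕ) :
    mockTerm (X ^ 2 * x) (n + 1) = mockTerm x n * X ^ (4 * n + 2) * (1 - (x * X) ^ 2) *
      unitInv (1 - x * X ^ (2 * n + 1)) * unitInv (1 - x * X ^ (2 * n + 3)) := by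
  have key : ∀ i : ℕ, 1 - X ^ 2 * x * X ^ (2 * i + 1) = 1 - x * X ^ (2 * i + 3) := fun i => by ring
  induction n with
  | zero =>
    have h := mul_unitInv (constantCoeff_one_sub_mul_X_pow_succ x (2 * 0))
    rw [mockTerm_succ, mockTerm_zero, mockTerm_zero, key]
    simp only [mul_zero, zero_add, pow_one] at h ⊢
    linear_combination -(X ^ 2 * (1 + x * X) * unitInv (1 - x * X ^ 3)) * h
  | succ n ih =>
    rw [mockTerm_succ, ih, mockTerm_succ, key]
    ring_nf

/-- The telescoping certificate for `mockTerm`. -/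
noncomputable def mockCert (x : PowerSeries ℤ) (n : ℕ) : PowerSeries ℤ :=
  mockTerm x n * X ^ (2 * n) * unitInv (1 - x * X ^ (2 * n + 1))

/-- A creative-telescoping relation: once the common factor `mockTerm x n` is taken out, it is an
identity of rational functions in x, q and q^{2n}. -/
theorem mockTerm_telescope (x : PowerSeries ℤ) (n : ℕ) :
    (1 - (x * X) ^ 2) * mockTerm x (n + 1) - (1 + (x * X) ^ 2) * mockTerm (X ^ 2 * x) (n + 1) =
      -((1 - (x * X) ^ 2) * (x * X)) * (mockCert x (n + 1) - mockCert x n) := by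
  have h := mul_unitInv (constantCoeff_one_sub_mul_X_pow_succ x (2 * n + 2))
  rw [mockTerm_shift, mockCert, mockCert, mockTerm_succ]
  have e : 2 * (n + 1) + 1 = 2 * n + 2 + 1 := by ring
  have e' : 2 * n + 3 = 2 * n + 2 + 1 := by ring
  rw [e, e']
  set I := unitInv (1 - x * X ^ (2 * n + 2 + 1))
  set J := unitInv (1 - x * X ^ (2 * n + 1))
  have e2 : (X : PowerSeries ℤ) ^ (2 * (n + 1)) = X ^ (2 * n) * X ^ 2 := by ring
  have e3 : (X : PowerSeries ℤ) ^ (2 * n + 2 + 1) = X ^ (2 * n) * X ^ 3 := by ring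
  have e4 : (X : PowerSeries ℤ) ^ (4 * n + 2) = (X ^ (2 * n)) ^ 2 * X ^ 2 := by ring
  have e5 : (X : PowerSeries ℤ) ^ (2 * n + 1) = X ^ (2 * n) * X := by ring
  rw [e3] at h
  rw [e2, e4, e5]
  linear_combination -((1 - (x * X) ^ 2) * mockTerm x n * J * X ^ (2 * n) *
    (x * X + X ^ 2 * X ^ (2 * n) - x * X)) * h

/-- Symmetric partial sums of the bilateral series. -/
noncomputable def mockSum (K : ℕ) (x : PowerSeries ℤ) : PowerSeries ℤ :=
  ∑ n ∈ Finset.range (K + 1), (mockTerm x n + mockTerm (-x) n) - 1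

/-- The coefficients involve x only through (xq)², so the telescoping relations for x and -x add up;
only the two end certificates survive. -/
theorem mockSum_shift (K : ℕ) (x : PowerSeries ℤ) :
    (1 - (x * X) ^ 2) * mockSum K x - (1 + (x * X) ^ 2) * mockSum K (X ^ 2 * x) =
      -((1 - (x * X) ^ 2) * (x * X)) * (mockCert x K - mockCert (-x) K) := by
  induction K with
  | zero =>
    have h := mul_unitInv (constantCoeff_one_sub_mul_X_pow_succ x 0)
    have h' := mul_unitInv (constantCoeff_one_sub_mul_X_pow_succ (-x) 0)
    simp only [mockSum, mockCert, mockTerm_zero, Finset.sum_range_one, zero_add, pow_one,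
      mul_zero, pow_zero, one_mul] at h h' ⊢
    linear_combination (x * X) * (1 + x * X) * h - (x * X) * (1 - x * X) * h'
  | succ K ih =>
    have h1 := mockTerm_telescope x K
    have h2 := mockTerm_telescope (-x) K
    rw [mul_neg] at h2
    have s : ∀ y, mockSum (K + 1) y = mockSum K y + (mockTerm y (K + 1) + mockTerm (-y) (K + 1)) := by
      intro y
      rw [mockSum, mockSum, Finset.sum_range_succ _ (K + 1)]
      ring
    rw [s, s]
    linear_combination ih + h1 + h2

theorem X_pow_dvd_mockTerm (x : PowerSeries ℤ) (n : ℕ) : X ^ n ∣ mockTerm x n := by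
  induction n with
  | zero => simp
  | succ n ih =>
    rw [mockTerm_succ, pow_succ]
    refine mul_dvd_mul ih (Dvd.dvd.mul_right (Dvd.dvd.mul_right ?_ _) _)
    exact dvd_pow_self _ (by omega)

theorem dvd_unitInv_one_sub (x : PowerSeries ℤ) (n : ℕ) :
    x ∣ unitInv (1 - x * X ^ (n + 1)) - 1 :=
  ⟨X ^ (n + 1) * unitInv (1 - x * X ^ (n + 1)), by
    linear_combination mul_unitInv (constantCoeff_one_sub_mul_X_pow_succ x n)⟩

/-- Identifies the limit x → 0, where the bilateral series becomes φ(q²). -/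
theorem dvd_mockTerm_sub (x : PowerSeries ℤ) (n : ℕ) : x ∣ mockTerm x n - X ^ (2 * n ^ 2) := by
  induction n with
  | zero => simp [mockTerm_zero]
  | succ n ih =>
    obtain ⟨a, ha⟩ := ih
    obtain ⟨b, hb⟩ := dvd_unitInv_one_sub x (2 * n)
    rw [mockTerm_succ, eq_add_of_sub_eq ha, eq_add_of_sub_eq hb]
    refine ⟨a * (X ^ (2 * n + 1) * (x + X ^ (2 * n + 1)) * (x * b + 1)) +
      X ^ (2 * n ^ 2) * X ^ (2 * n + 1) * (x * b + 1 + X ^ (2 * n + 1) * b), ?_⟩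
    ring

theorem mockSum_pow_dvd (K N : ℕ) :
    X ^ K ∣ (∏ i ∈ Finset.range N, (1 - X ^ (4 * i + 2))) * mockSum K 1 -
      (∏ i ∈ Finset.range N, (1 + X ^ (4 * i + 2))) * mockSum K (X ^ (2 * N)) := by
  induction N with
  | zero => simp
  | succ N ih =>
    have h := mockSum_shift K (X ^ (2 * N))
    have c1 : X ^ K ∣ mockCert (X ^ (2 * N)) K :=
      Dvd.dvd.mul_right (Dvd.dvd.mul_right (X_pow_dvd_mockTerm _ _) _) _
    have c2 : X ^ K ∣ mockCert (-X ^ (2 * N)) K :=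
      Dvd.dvd.mul_right (Dvd.dvd.mul_right (X_pow_dvd_mockTerm _ _) _) _
    have e : (X : PowerSeries ℤ) ^ 2 * X ^ (2 * N) = X ^ (2 * (N + 1)) := by ring
    have e' : ((X : PowerSeries ℤ) ^ (2 * N) * X) ^ 2 = X ^ (4 * N + 2) := by ring
    rw [e, e'] at h
    rw [Finset.prod_range_succ, Finset.prod_range_succ]
    obtain ⟨a, ha⟩ := ih
    obtain ⟨b, hb⟩ := c1
    obtain ⟨c, hc⟩ := c2
    rw [hb, hc] at h
    refine ⟨a * (1 - X ^ (4 * N + 2)) - (∏ i ∈ Finset.range N, (1 + X ^ (4 * i + 2))) *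
      ((1 - X ^ (4 * N + 2)) * (X ^ (2 * N) * X)) * (b - c), ?_⟩
    linear_combination (1 - X ^ (4 * N + 2)) * ha +
      (∏ i ∈ Finset.range N, (1 + X ^ (4 * i + 2))) * h

/-! ### The theta series of Gauss -/

/-- The summand `∏_{i<n} q (q^{2i} - b) / (1 - b q^{2i+2})`. -/
noncomputable def gaussTerm (b : PowerSeries ℤ) (n : ℕ) : PowerSeries ℤ :=
  ∏ i ∈ Finset.range n, (X * (X ^ (2 * i) - b) * unitInv (1 - b * X ^ (2 * i + 2)))

theorem gaussTerm_succ (b : PowerSeries ℤ) (n : ℕ) :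
    gaussTerm b (n + 1) = gaussTerm b n *
      (X * (X ^ (2 * n) - b) * unitInv (1 - b * X ^ (2 * n + 2))) :=
  Finset.prod_range_succ _ _

theorem gaussTerm_zero (b : PowerSeries ℤ) : gaussTerm b 0 = 1 := Finset.prod_range_zero _

theorem gaussTerm_shift (b : PowerSeries ℤ) (n : ℕ) :
    gaussTerm (X ^ 2 * b) (n + 1) = gaussTerm b n * X ^ (2 * n + 1) * (1 - b * X ^ 2) ^ 2 *
      unitInv (1 - b * X ^ (2 * n + 2)) * unitInv (1 - b * X ^ (2 * n + 4)) := by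
  have key : ∀ i : ℕ, 1 - X ^ 2 * b * X ^ (2 * i + 2) = 1 - b * X ^ (2 * i + 4) := fun i => by ring
  induction n with
  | zero =>
    have h := mul_unitInv (constantCoeff_one_sub_mul_X_pow_succ b 1)
    rw [gaussTerm_succ, gaussTerm_zero, gaussTerm_zero, key]
    simp only [mul_zero, zero_add, pow_one, pow_zero, Nat.reduceAdd] at h ⊢
    linear_combination -(X * (1 - b * X ^ 2) * unitInv (1 - b * X ^ 4)) * h
  | succ n ih =>
    rw [gaussTerm_succ, ih, gaussTerm_succ, key]
    ring_nf

/-- The telescoping certificate for `gaussTerm`. -/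
noncomputable def gaussCert (b : PowerSeries ℤ) (n : ℕ) : PowerSeries ℤ :=
  b * X * (1 - b * X ^ 2) * gaussTerm b n * (1 - X ^ (2 * n + 1)) *
    unitInv (1 - b * X ^ (2 * n + 2))

/-- The same method as for `mockTerm`, with b running from 1, where the series terminates, to 0,
where it is φ(q). -/
theorem gaussTerm_telescope (b : PowerSeries ℤ) (n : ℕ) :
    (1 + b * X) * (1 - b * X ^ 2) * gaussTerm b (n + 1) -
      (1 - b * X) * (1 + b * X ^ 2) * gaussTerm (X ^ 2 * b) (n + 1) =
      gaussCert b (n + 1) - gaussCert b n := by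
  have h := mul_unitInv (constantCoeff_one_sub_mul_X_pow_succ b (2 * n + 3))
  rw [gaussTerm_shift, gaussCert, gaussCert, gaussTerm_succ]
  have e : 2 * (n + 1) + 2 = 2 * n + 3 + 1 := by ring
  have e' : 2 * n + 4 = 2 * n + 3 + 1 := by ring
  rw [e, e']
  set I := unitInv (1 - b * X ^ (2 * n + 3 + 1))
  set J := unitInv (1 - b * X ^ (2 * n + 2))
  have e2 : (X : PowerSeries ℤ) ^ (2 * (n + 1) + 1) = X ^ (2 * n) * X ^ 3 := by ring
  have e3 : (X : PowerSeries ℤ) ^ (2 * n + 3 + 1) = X ^ (2 * n) * X ^ 4 := by ring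
  have e5 : (X : PowerSeries ℤ) ^ (2 * n + 1) = X ^ (2 * n) * X := by ring
  rw [e3] at h
  rw [e2, e5]
  linear_combination -(gaussTerm b n * J * (1 - b * X ^ 2) * X * ((1 + b * X) * (X ^ (2 * n) - b) +
    b * (1 - X ^ (2 * n) * X))) * h

/-- Symmetric partial sums of the bilateral series `gaussTerm`. -/
noncomputable def thetaPartial (K : ℕ) (b : PowerSeries ℤ) : PowerSeries ℤ :=
  2 * ∑ n ∈ Finset.range (K + 1), gaussTerm b n - 1

theorem thetaPartial_shift (K : ℕ) (b : PowerSeries ℤ) :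
    (1 + b * X) * (1 - b * X ^ 2) * thetaPartial K b -
      (1 - b * X) * (1 + b * X ^ 2) * thetaPartial K (X ^ 2 * b) = 2 * gaussCert b K := by
  induction K with
  | zero =>
    have h := mul_unitInv (constantCoeff_one_sub_mul_X_pow_succ b 1)
    simp only [thetaPartial, gaussCert, gaussTerm_zero, Finset.sum_range_one, zero_add, pow_one,
      mul_zero, mul_one, Nat.reduceAdd] at h ⊢
    linear_combination -2 * (b * X * (1 - X)) * h
  | succ K ih =>
    have s : ∀ y, thetaPartial (K + 1) y = thetaPartial K y + 2 * gaussTerm y (K + 1) := by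
      intro y
      rw [thetaPartial, thetaPartial, Finset.sum_range_succ _ (K + 1)]
      ring
    rw [s, s]
    linear_combination ih + 2 * gaussTerm_telescope b K

theorem X_pow_dvd_gaussTerm (b : PowerSeries ℤ) (n : ℕ) : X ^ n ∣ gaussTerm b n := by
  induction n with
  | zero => simp
  | succ n ih =>
    rw [gaussTerm_succ, pow_succ]
    exact mul_dvd_mul ih (Dvd.dvd.mul_right (Dvd.intro _ rfl) _)

theorem dvd_gaussTerm_sub (b : PowerSeries ℤ) (n : ℕ) : b ∣ gaussTerm b n - X ^ (n ^ 2) := by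
  induction n with
  | zero => simp [gaussTerm_zero]
  | succ n ih =>
    obtain ⟨a, ha⟩ := ih
    obtain ⟨c, hc⟩ := dvd_unitInv_one_sub b (2 * n + 1)
    rw [gaussTerm_succ, eq_add_of_sub_eq ha, eq_add_of_sub_eq hc]
    refine ⟨a * (X * (X ^ (2 * n) - b) * (b * c + 1)) +
      X ^ (n ^ 2) * X * (X ^ (2 * n) * c - (b * c + 1)), ?_⟩
    ring

theorem gaussTerm_one_succ (n : ℕ) : gaussTerm 1 (n + 1) = 0 := by
  rw [gaussTerm, Finset.prod_eq_zero (Finset.mem_range.2 n.succ_pos)]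
  simp

theorem thetaPartial_one (K : ℕ) : thetaPartial K 1 = 1 := by
  rw [thetaPartial, Finset.sum_range_succ', gaussTerm_zero,
    Finset.sum_eq_zero fun n _ => gaussTerm_one_succ n]
  ring

theorem thetaPartial_pow_dvd (K N : ℕ) :
    X ^ K ∣ (∏ i ∈ Finset.range N, (1 + X ^ (2 * i + 1)) * (1 - X ^ (2 * i + 2))) -
      (∏ i ∈ Finset.range N, (1 - X ^ (2 * i + 1)) * (1 + X ^ (2 * i + 2))) *
        thetaPartial K (X ^ (2 * N)) := by
  induction N with
  | zero => simp [thetaPartial_one]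
  | succ N ih =>
    have h := thetaPartial_shift K (X ^ (2 * N))
    have c1 : X ^ K ∣ gaussCert (X ^ (2 * N)) K :=
      Dvd.dvd.mul_right (Dvd.dvd.mul_right (Dvd.dvd.mul_left (X_pow_dvd_gaussTerm _ _) _) _) _
    have e : (X : PowerSeries ℤ) ^ 2 * X ^ (2 * N) = X ^ (2 * (N + 1)) := by ring
    have e1 : (X : PowerSeries ℤ) ^ (2 * N) * X = X ^ (2 * N + 1) := by ring
    have e2 : (X : PowerSeries ℤ) ^ (2 * N) * X ^ 2 = X ^ (2 * N + 2) := by ring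
    rw [e, e1, e2] at h
    rw [Finset.prod_range_succ, Finset.prod_range_succ]
    obtain ⟨a, ha⟩ := ih
    obtain ⟨c, hc⟩ := c1
    rw [hc] at h
    refine ⟨a * ((1 + X ^ (2 * N + 1)) * (1 - X ^ (2 * N + 2))) +
      2 * (∏ i ∈ Finset.range N, (1 - X ^ (2 * i + 1)) * (1 + X ^ (2 * i + 2))) * c, ?_⟩
    linear_combination ((1 + X ^ (2 * N + 1)) * (1 - X ^ (2 * N + 2))) * ha +
      (∏ i ∈ Finset.range N, (1 - X ^ (2 * i + 1)) * (1 + X ^ (2 * i + 2))) * h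

/-! ### Theta series -/

/-- Ramanujan's theta series `φ(q) = ∑_{n ∈ ℤ} q^{n^2}`. -/
noncomputable def theta : PowerSeries ℤ :=
  mk fun n => if n = 0 then 1 else if IsSquare n then 2 else 0

/-- The substitution `q ↦ q^2`. -/
noncomputable abbrev expandTwo : PowerSeries ℤ →ₐ[ℤ] PowerSeries ℤ := expand 2 two_ne_zero

/-- The substitution `q ↦ q^4`. -/
noncomputable abbrev expandFour : PowerSeries ℤ →ₐ[ℤ] PowerSeries ℤ := expand 4 four_ne_zero

/-- `φ(-q)`. -/
noncomputable def thetaNeg : PowerSeries ℤ := evalNegHom theta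

/-- The series `∑ q^{n^2}` over the odd positive integers `n`. -/
noncomputable def oddTheta : PowerSeries ℤ :=
  mk fun n => if IsSquare n ∧ Odd n then 1 else 0

theorem coeff_evalNegHom (f : PowerSeries ℤ) (n : ℕ) :
    coeff n (evalNegHom f) = (-1) ^ n * coeff n f := by
  rw [evalNegHom, coeff_rescale]

theorem expandTwo_expandTwo (f : PowerSeries ℤ) : expandTwo (expandTwo f) = expandFour f :=
  (expand_mul 2 two_ne_zero 2 two_ne_zero f).symm

theorem coeff_expandTwo_mul (f : PowerSeries ℤ) (n : ℕ) :
    coeff (2 * n) (expandTwo f) = coeff n f := coeff_expand_mul _ _ _ _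

theorem coeff_expandFour_mul (f : PowerSeries ℤ) (n : ℕ) :
    coeff (4 * n) (expandFour f) = coeff n f := coeff_expand_mul _ _ _ _

theorem theta_eq_add : theta = expandFour theta + 2 * oddTheta := by
  ext n
  have h2 : coeff n (2 * oddTheta) = 2 * coeff n oddTheta := by
    rw [two_mul, map_add, two_mul]
  rw [map_add, h2, oddTheta, coeff_mk, coeff_expand]
  simp only [theta, coeff_mk]
  by_cases h4 : 4 ∣ n
  · obtain ⟨m, rfl⟩ := h4
    have ho : ¬ Odd (4 * m) := by rw [Nat.not_odd_iff_even]; exact ⟨2 * m, by ring⟩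
    have hs : IsSquare (4 * m) ↔ IsSquare m := by
      constructor
      · rintro ⟨r, hr⟩
        have : 2 ∣ r := by
          have : 2 ∣ r * r := by omega
          exact (Nat.prime_two.dvd_mul.1 this).elim id id
        obtain ⟨s, rfl⟩ := this
        exact ⟨s, by nlinarith⟩
      · rintro ⟨r, rfl⟩
        exact ⟨2 * r, by ring⟩
    simp [ho, hs]
  · have h0 : n ≠ 0 := by rintro rfl; simp at h4
    have : IsSquare n → Odd n := by
      rintro ⟨r, rfl⟩
      rcases Nat.even_or_odd r with ⟨s, rfl⟩ | hr
      · exact absurd ⟨s * s, by ring⟩ h4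
      · exact hr.mul hr
    by_cases hs : IsSquare n
    · simp [h4, h0, hs, this hs]
    · simp [h4, h0, hs]

/-! ### Supports in residue classes -/

/-- `f` is supported on exponents congruent to `r` modulo `k`. -/
def SupportedMod (k r : ℕ) (f : PowerSeries ℤ) : Prop :=
  ∀ n, ¬ n ≡ r [MOD k] → coeff n f = 0

theorem SupportedMod.mul {k r s : ℕ} {f g : PowerSeries ℤ} (hf : SupportedMod k r f)
    (hg : SupportedMod k s g) : SupportedMod k (r + s) (f * g) := by
  intro n hn
  rw [coeff_mul]
  refine Finset.sum_eq_zero fun p hp => ?_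
  rw [Finset.HasAntidiagonal.mem_antidiagonal] at hp
  by_cases h1 : p.1 ≡ r [MOD k]
  · by_cases h2 : p.2 ≡ s [MOD k]
    · exact absurd (hp ▸ h1.add h2) hn
    · rw [hg _ h2, mul_zero]
  · rw [hf _ h1, zero_mul]

theorem SupportedMod.pow {k r : ℕ} {f : PowerSeries ℤ} (hf : SupportedMod k r f) (m : ℕ) :
    SupportedMod k (m * r) (f ^ m) := by
  induction m with
  | zero =>
    intro n hn
    rw [pow_zero, coeff_one, if_neg]
    rintro rfl
    exact hn (by simp [Nat.ModEq])
  | succ m ih =>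
    rw [pow_succ, add_mul, one_mul]
    exact ih.mul hf

theorem SupportedMod.of_dvd {k l r : ℕ} {f : PowerSeries ℤ} (hf : SupportedMod k r f)
    (h : l ∣ k) : SupportedMod l r f :=
  fun n hn => hf n fun h' => hn (h'.of_dvd h)

theorem supportedMod_expandFour (f : PowerSeries ℤ) : SupportedMod 4 0 (expandFour f) :=
  fun _ hn => coeff_expand_of_not_dvd _ _ _ fun h => hn ((Nat.modEq_zero_iff_dvd).2 h)

theorem supportedMod_oddTheta : SupportedMod 8 1 oddTheta := by
  intro n hn
  rw [oddTheta, coeff_mk, if_neg]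
  rintro ⟨⟨r, rfl⟩, ho⟩
  have hr : Odd r := (Nat.odd_mul.1 ho).1
  apply hn
  have : r % 8 = 1 ∨ r % 8 = 3 ∨ r % 8 = 5 ∨ r % 8 = 7 := by
    have := Nat.odd_iff.1 hr
    omega
  rw [Nat.ModEq, Nat.mul_mod]
  rcases this with h | h | h | h <;> rw [h]

theorem thetaNeg_eq_sub : thetaNeg = expandFour theta - 2 * oddTheta := by
  rw [thetaNeg]
  conv_lhs => rw [theta_eq_add]
  rw [map_add, map_mul, map_ofNat]
  have h1 : evalNegHom (expandFour theta) = expandFour theta := by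
    ext n
    rw [coeff_evalNegHom]
    by_cases h : n ≡ 0 [MOD 4]
    · have : Even n := by
        have := (Nat.modEq_zero_iff_dvd).1 h
        exact even_iff_two_dvd.2 (dvd_trans (by norm_num) this)
      rw [this.neg_one_pow, one_mul]
    · rw [supportedMod_expandFour _ n h, mul_zero]
  have h2 : evalNegHom oddTheta = -oddTheta := by
    ext n
    rw [coeff_evalNegHom, map_neg]
    by_cases h : n ≡ 1 [MOD 8]
    · have : Odd n := by
        rw [Nat.odd_iff]
        exact h.of_dvd (by norm_num)
      rw [this.neg_one_pow]
      ring
    · rw [supportedMod_oddTheta n h, mul_zero, neg_zero]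
  rw [h1, h2]
  ring

theorem X_pow_dvd_theta_sub (K : ℕ) :
    X ^ K ∣ theta - (2 * ∑ n ∈ Finset.range (K + 1), X ^ (n ^ 2) - 1) := by
  rw [X_pow_dvd_iff]
  intro m hm
  rw [two_mul, map_sub, map_sub, map_add, map_sum, coeff_one, theta, coeff_mk]
  simp only [coeff_X_pow]
  by_cases hs : IsSquare m
  · obtain ⟨r, rfl⟩ := hs
    have hr : r ∈ Finset.range (K + 1) := by
      rw [Finset.mem_range]
      nlinarith
    rw [Finset.sum_eq_single_of_mem r hr]
    · rcases Nat.eq_zero_or_pos r with rfl | h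
      · simp
      · simp [h.ne', sq]
    · intro b _ hb
      rw [if_neg]
      intro h
      apply hb
      nlinarith [Nat.pow_left_injective (n := 2) (by norm_num) (show b ^ 2 = r ^ 2 by rw [← h, sq])]
  · have h0 : m ≠ 0 := by rintro rfl; exact hs ⟨0, rfl⟩
    rw [Finset.sum_eq_zero]
    · simp [h0, hs]
    · intro b _
      rw [if_neg]
      rintro rfl
      exact hs ⟨b, sq b⟩

theorem sum_Icc_eq (K : ℕ) :
    ∑ a ∈ Finset.Icc (-(K : ℤ)) K, (X : PowerSeries ℤ) ^ (a.natAbs ^ 2) =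
      2 * ∑ n ∈ Finset.range (K + 1), X ^ (n ^ 2) - 1 := by
  induction K with
  | zero => simp; norm_num
  | succ K ih =>
    have : Finset.Icc (-((K + 1 : ℕ) : ℤ)) ((K + 1 : ℕ) : ℤ) =
        insert (-((K + 1 : ℕ) : ℤ)) (insert ((K + 1 : ℕ) : ℤ) (Finset.Icc (-(K : ℤ)) K)) := by
      ext a
      simp only [Finset.mem_Icc, Finset.mem_insert]
      omega
    rw [this, Finset.sum_insert, Finset.sum_insert, ih, Finset.sum_range_succ _ (K + 1),
      Int.natAbs_neg, Int.natAbs_natCast]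
    · ring
    · simp
    · simp only [Finset.mem_Icc, Finset.mem_insert]
      omega

/-! ### Sums of two squares and the quadratic relations for φ -/

/-- The coefficients of `φ(q)^2` count representations as sums of two squares. -/
theorem coeff_theta_sq (n L : ℕ) (h : n < L) :
    coeff n (theta ^ 2) = (((Finset.Icc (-(L : ℤ)) L ×ˢ Finset.Icc (-(L : ℤ)) L).filter
      fun p => p.1 ^ 2 + p.2 ^ 2 = (n : ℤ)).card : ℤ) := by
  have h1 : X ^ L ∣ theta ^ 2 - (∑ a ∈ Finset.Icc (-(L : ℤ)) L, X ^ (a.natAbs ^ 2)) ^ 2 := by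
    rw [sum_Icc_eq, sq_sub_sq]
    exact Dvd.dvd.mul_left (X_pow_dvd_theta_sub L) _
  have h2 := X_pow_dvd_iff.1 h1 n h
  rw [map_sub, sub_eq_zero] at h2
  rw [h2, sq, Finset.sum_mul_sum, ← Finset.sum_product', map_sum, Finset.card_filter]
  push_cast
  refine Finset.sum_congr rfl fun p _ => ?_
  rw [← pow_add, coeff_X_pow]
  refine if_congr ?_ rfl rfl
  rw [← Int.natAbs_sq p.1, ← Int.natAbs_sq p.2]
  norm_cast
  exact eq_comm

theorem coeff_two_mul_theta_sq (m : ℕ) : coeff (2 * m) (theta ^ 2) = coeff m (theta ^ 2) := by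
  rw [coeff_theta_sq (2 * m) (2 * m + 1) (by omega), coeff_theta_sq m (2 * m + 1) (by omega)]
  congr 1
  symm
  refine Finset.card_bij (fun p _ => (p.1 + p.2, p.1 - p.2)) ?_ ?_ ?_
  · rintro ⟨a, b⟩ hp
    simp only [Finset.mem_filter, Finset.mem_product, Finset.mem_Icc] at hp ⊢
    obtain ⟨-, h⟩ := hp
    push_cast at h ⊢
    refine ⟨⟨⟨?_, ?_⟩, ?_, ?_⟩, ?_⟩ <;> nlinarith [sq_nonneg (a + b + 1), sq_nonneg (a + b - 1),
      sq_nonneg (a - b + 1), sq_nonneg (a - b - 1), sq_nonneg (a + b), sq_nonneg (a - b)]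
  · rintro ⟨a, b⟩ _ ⟨c, d⟩ _ h
    simp only [Prod.mk.injEq] at h ⊢
    omega
  · rintro ⟨c, d⟩ hp
    simp only [Finset.mem_filter, Finset.mem_product, Finset.mem_Icc] at hp
    obtain ⟨-, h⟩ := hp
    push_cast at h
    -- The preimage of (c, d) is ((c + d)/2, (c - d)/2), integral because c² + d² is even.
    have hpar : Even (c + d) := by
      have : Even (c ^ 2 + d ^ 2) := ⟨m, by linarith⟩
      rw [Int.even_add, Int.even_pow' two_ne_zero, Int.even_pow' two_ne_zero] at this
      rwa [Int.even_add]
    obtain ⟨a, ha⟩ := hpar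
    have h' : a ^ 2 + (c - a) ^ 2 = m := by
      obtain rfl : d = a + a - c := by linarith
      nlinarith
    refine ⟨(a, c - a), ?_, ?_⟩
    · simp only [Finset.mem_filter, Finset.mem_product, Finset.mem_Icc]
      push_cast
      refine ⟨⟨⟨?_, ?_⟩, ?_, ?_⟩, h'⟩ <;> nlinarith [sq_nonneg (a + 1), sq_nonneg (a - 1),
        sq_nonneg (c - a + 1), sq_nonneg (c - a - 1), sq_nonneg a, sq_nonneg (c - a)]
    · ext <;> simp; linarith

theorem coeff_two_mul (f : PowerSeries ℤ) (n : ℕ) : coeff n (2 * f) = 2 * coeff n f := by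
  rw [two_mul, map_add, two_mul]

theorem SupportedMod.coeff_eq_zero {k r n : ℕ} {f : PowerSeries ℤ} (hf : SupportedMod k r f)
    (h : n % k ≠ r % k) : coeff n f = 0 := hf n h

/-- In φ² = (E + 2O)², with E the even and 2O the odd squares, the cross term has odd exponents. The
left side is thus the even part of φ², which is φ(q²)² because 2m and m have equally many
representations by two squares. -/
theorem expandFour_theta_sq_add :
    expandFour theta ^ 2 + 4 * oddTheta ^ 2 = expandTwo (theta ^ 2) := by
  have hE := (supportedMod_expandFour theta).pow 2
  have hO := supportedMod_oddTheta.pow 2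
  have hEO := ((supportedMod_expandFour theta).mul (supportedMod_oddTheta.of_dvd
    (show 4 ∣ 8 by norm_num)))
  have h4 : ∀ f : PowerSeries ℤ, 4 * f = 2 * (2 * f) := fun f => by ring
  ext n
  rw [map_add, h4, coeff_two_mul, coeff_two_mul]
  rcases Nat.even_or_odd' n with ⟨m, rfl | rfl⟩
  · rw [coeff_expandTwo_mul, ← coeff_two_mul_theta_sq]
    conv_rhs => rw [theta_eq_add]
    have : (expandFour theta + 2 * oddTheta) ^ 2 = expandFour theta ^ 2 +
      2 * (2 * oddTheta ^ 2) + 2 * (2 * (expandFour theta * oddTheta)) := by ring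
    rw [this, map_add, map_add, coeff_two_mul, coeff_two_mul, coeff_two_mul, coeff_two_mul,
      hEO.coeff_eq_zero (by omega)]
    ring
  · rw [hE.coeff_eq_zero (by omega), hO.coeff_eq_zero (by omega),
      coeff_expand_of_not_dvd _ _ _ (by omega)]
    ring

/-- The previous identity with q² replaced by -q²: E² lives on exponents 0 mod 4 and O² on 2 mod 8,
so only O² changes sign. -/
theorem expandFour_theta_sq_sub :
    expandFour theta ^ 2 - 4 * oddTheta ^ 2 = expandTwo (thetaNeg ^ 2) := by
  have hE := (supportedMod_expandFour theta).pow 2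
  have hO := supportedMod_oddTheta.pow 2
  have h4 : ∀ f : PowerSeries ℤ, 4 * f = 2 * (2 * f) := fun f => by ring
  ext n
  have h := congrArg (coeff n) expandFour_theta_sq_add
  rw [map_add, h4, coeff_two_mul, coeff_two_mul] at h
  rw [map_sub, h4, coeff_two_mul, coeff_two_mul]
  rcases Nat.even_or_odd' n with ⟨m, rfl | rfl⟩
  · rw [coeff_expandTwo_mul] at h
    rw [coeff_expandTwo_mul, thetaNeg, ← map_pow evalNegHom, coeff_evalNegHom, ← h]
    rcases Nat.even_or_odd m with hm | hm
    · obtain ⟨k, rfl⟩ := hm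
      rw [hO.coeff_eq_zero (by omega), Even.neg_one_pow ⟨k, rfl⟩]
      ring
    · rw [hm.neg_one_pow]
      obtain ⟨k, rfl⟩ := hm
      rw [hE.coeff_eq_zero (by omega)]
      ring
  · rw [hE.coeff_eq_zero (by omega), hO.coeff_eq_zero (by omega),
      coeff_expand_of_not_dvd _ _ _ (by omega)]
    ring

theorem theta_mul_thetaNeg : theta * thetaNeg = expandTwo (thetaNeg ^ 2) := by
  rw [← expandFour_theta_sq_sub, thetaNeg_eq_sub]
  linear_combination (expandFour theta - 2 * oddTheta) * theta_eq_add

/-- Factoring the difference gives (φ(q²) φ(-q²))², and φ(q) φ(-q) = φ(-q²)² is applied at q². This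
is what makes τ⁴ a series in q⁴. -/
theorem expandFour_theta_pow_four_sub :
    expandFour theta ^ 4 - 16 * oddTheta ^ 4 = expandFour (thetaNeg ^ 4) := by
  have h : expandFour theta ^ 4 - 16 * oddTheta ^ 4 =
      (expandFour theta ^ 2 + 4 * oddTheta ^ 2) * (expandFour theta ^ 2 - 4 * oddTheta ^ 2) := by
    ring
  rw [h, expandFour_theta_sq_add, expandFour_theta_sq_sub, ← map_mul, ← mul_pow,
    theta_mul_thetaNeg, ← expandTwo_expandTwo, ← map_pow]
  ring_nf

theorem constantCoeff_theta : constantCoeff theta = 1 := by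
  rw [← coeff_zero_eq_constantCoeff_apply, theta, coeff_mk, if_pos rfl]

theorem constantCoeff_thetaNeg : constantCoeff thetaNeg = 1 := by
  rw [← coeff_zero_eq_constantCoeff_apply, thetaNeg, coeff_evalNegHom,
    coeff_zero_eq_constantCoeff_apply, constantCoeff_theta]
  norm_num

/-! ### The even part of the generating function of `v0` -/

theorem mockTerm_mul_prod (x : PowerSeries ℤ) (n : ℕ) :
    mockTerm x n * ∏ i ∈ Finset.range n, (1 - x * X ^ (2 * i + 1)) =
      X ^ (n ^ 2) * ∏ i ∈ Finset.range n, (x + X ^ (2 * i + 1)) := by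
  induction n with
  | zero => simp [mockTerm_zero]
  | succ n ih =>
    have h := mul_unitInv (constantCoeff_one_sub_mul_X_pow_succ x (2 * n))
    rw [mockTerm_succ, Finset.prod_range_succ, Finset.prod_range_succ]
    have e : (X : PowerSeries ℤ) ^ ((n + 1) ^ 2) = X ^ (n ^ 2) * X ^ (2 * n + 1) := by ring
    rw [e]
    linear_combination (X ^ (2 * n + 1) * (x + X ^ (2 * n + 1))) * ih + (mockTerm x n *
      (∏ i ∈ Finset.range n, (1 - x * X ^ (2 * i + 1))) * X ^ (2 * n + 1) *
        (x + X ^ (2 * n + 1))) * h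

theorem ne_zero_of_constantCoeff_eq_one {f : PowerSeries ℤ} (h : constantCoeff f = 1) :
    f ≠ 0 := by
  rintro rfl
  simp at h

theorem qPochhammer_X_eq (n : ℕ) : qPochhammer (X : PowerSeries ℤ) (X ^ 2) n =
    ∏ i ∈ Finset.range n, (1 - X ^ (2 * i + 1)) :=
  Finset.prod_congr rfl fun i _ => by ring

theorem qPochhammer_neg_X_eq (n : ℕ) : qPochhammer (-X : PowerSeries ℤ) (X ^ 2) n =
    ∏ i ∈ Finset.range n, (1 + X ^ (2 * i + 1)) :=
  Finset.prod_congr rfl fun i _ => by ring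

theorem mockTerm_one (n : ℕ) : mockTerm 1 n = v0Term n := by
  have h1 := mockTerm_mul_prod 1 n
  have h2 := v0Term_mul_denom n
  simp only [one_mul] at h1
  rw [qPochhammer_neg_X_eq, ← h1, ← qPochhammer_X_eq] at h2
  exact (mul_right_cancel₀
    (ne_zero_of_constantCoeff_eq_one (constantCoeff_qPochhammer_X n)) h2).symm

theorem evalNegHom_X_pow_odd (i : ℕ) :
    evalNegHom ((X : PowerSeries ℤ) ^ (2 * i + 1)) = -X ^ (2 * i + 1) := by
  rw [map_pow, evalNegHom_X, Odd.neg_pow ⟨i, rfl⟩]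

theorem evalNegHom_X_pow_even (i : ℕ) :
    evalNegHom ((X : PowerSeries ℤ) ^ (2 * i + 2)) = X ^ (2 * i + 2) := by
  rw [map_pow, evalNegHom_X, Even.neg_pow ⟨i + 1, by ring⟩]

theorem evalNegHom_prod_sub (n : ℕ) :
    evalNegHom (∏ i ∈ Finset.range n, (1 - (X : PowerSeries ℤ) ^ (2 * i + 1))) =
      ∏ i ∈ Finset.range n, (1 + X ^ (2 * i + 1)) := by
  rw [map_prod]
  exact Finset.prod_congr rfl fun i _ => by
    rw [map_sub, map_one, evalNegHom_X_pow_odd, sub_neg_eq_add]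

theorem evalNegHom_prod_add (n : ℕ) :
    evalNegHom (∏ i ∈ Finset.range n, (1 + (X : PowerSeries ℤ) ^ (2 * i + 1))) =
      ∏ i ∈ Finset.range n, (1 - X ^ (2 * i + 1)) := by
  rw [map_prod]
  exact Finset.prod_congr rfl fun i _ => by
    rw [map_add, map_one, evalNegHom_X_pow_odd, sub_eq_add_neg]

/-- The signs (-1)^{n²} and (-1)^n agree, so the negative half of the bilateral series at x = 1
produces F(-q). -/
theorem mockTerm_neg_one (n : ℕ) : mockTerm (-1) n = evalNegHom (v0Term n) := by
  have h1 := mockTerm_mul_prod (-1) n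
  have h2 := congrArg evalNegHom (v0Term_mul_denom n)
  rw [qPochhammer_neg_X_eq, qPochhammer_X_eq, map_mul, map_mul, evalNegHom_prod_add,
    evalNegHom_prod_sub, map_pow, evalNegHom_X] at h2
  have e1 : ∏ i ∈ Finset.range n, (1 - -1 * (X : PowerSeries ℤ) ^ (2 * i + 1)) =
      ∏ i ∈ Finset.range n, (1 + X ^ (2 * i + 1)) :=
    Finset.prod_congr rfl fun i _ => by ring
  have e2 : ∏ i ∈ Finset.range n, (-1 + (X : PowerSeries ℤ) ^ (2 * i + 1)) =
      (-1) ^ n * ∏ i ∈ Finset.range n, (1 - X ^ (2 * i + 1)) := by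
    rw [← Finset.card_range n, ← Finset.prod_const, Finset.card_range, ← Finset.prod_mul_distrib]
    exact Finset.prod_congr rfl fun i _ => by ring
  have e3 : (-1 : PowerSeries ℤ) ^ (n ^ 2) = (-1) ^ n := by
    rcases Nat.even_or_odd n with h | h
    · rw [h.neg_one_pow, (h.pow_of_ne_zero two_ne_zero).neg_one_pow]
    · rw [h.neg_one_pow, h.pow.neg_one_pow]
  rw [e1, e2] at h1
  rw [neg_pow, e3] at h2
  have h3 : constantCoeff (∏ i ∈ Finset.range n, (1 + (X : PowerSeries ℤ) ^ (2 * i + 1))) = 1 := by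
    simp [map_prod]
  apply mul_right_cancel₀ (ne_zero_of_constantCoeff_eq_one h3)
  rw [h1, h2]
  ring

/-- Twice the even part of the generating function of `v0`, minus one. -/
noncomputable def v0Even : PowerSeries ℤ := mk v0 + evalNegHom (mk v0) - 1

theorem X_pow_dvd_mk_v0_sub (K : ℕ) :
    X ^ K ∣ mk v0 - ∑ n ∈ Finset.range (K + 1), v0Term n := by
  rw [X_pow_dvd_iff]
  intro m hm
  rw [map_sub, coeff_mk, v0, map_sum, sub_eq_zero]
  refine Finset.sum_subset (Finset.range_mono (by omega)) fun k _ hk => coeff_v0Term_of_lt ?_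
  rw [Finset.mem_range] at hk
  omega

theorem X_pow_dvd_evalNegHom {K : ℕ} {f : PowerSeries ℤ} (h : X ^ K ∣ f) :
    X ^ K ∣ evalNegHom f := by
  rw [X_pow_dvd_iff] at h ⊢
  intro m hm
  rw [coeff_evalNegHom, h m hm, mul_zero]

theorem X_pow_dvd_expandTwo {K : ℕ} {f : PowerSeries ℤ} (h : X ^ K ∣ f) :
    X ^ K ∣ expandTwo f := by
  obtain ⟨g, rfl⟩ := h
  rw [map_mul, map_pow, expand_X, ← pow_mul, mul_comm 2 K, pow_mul, sq, mul_assoc]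
  exact Dvd.intro _ rfl

theorem X_pow_dvd_v0Even_sub (K : ℕ) : X ^ K ∣ v0Even - mockSum K 1 := by
  have h1 := X_pow_dvd_mk_v0_sub K
  have h2 := X_pow_dvd_evalNegHom h1
  have h3 := dvd_add h1 h2
  convert! h3 using 1
  rw [v0Even, mockSum, Finset.sum_add_distrib, map_sub, map_sum]
  simp only [mockTerm_one, mockTerm_neg_one]
  ring

theorem X_pow_dvd_mockSum_sub (K N : ℕ) (h : K ≤ N) :
    X ^ K ∣ mockSum K (X ^ (2 * N)) - expandTwo theta := by
  have h1 : X ^ K ∣ mockSum K (X ^ (2 * N)) -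
      (2 * ∑ n ∈ Finset.range (K + 1), X ^ (2 * n ^ 2) - 1) := by
    have e : mockSum K (X ^ (2 * N)) - (2 * ∑ n ∈ Finset.range (K + 1), X ^ (2 * n ^ 2) - 1) =
        ∑ n ∈ Finset.range (K + 1), ((mockTerm (X ^ (2 * N)) n - X ^ (2 * n ^ 2)) +
          (mockTerm (-X ^ (2 * N)) n - X ^ (2 * n ^ 2))) := by
      rw [mockSum, Finset.sum_add_distrib, Finset.sum_add_distrib, Finset.sum_sub_distrib,
        Finset.sum_sub_distrib]
      ring
    rw [e]
    have hd : (X : PowerSeries ℤ) ^ K ∣ X ^ (2 * N) := pow_dvd_pow _ (by omega)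
    refine Finset.dvd_sum fun n _ => dvd_add (hd.trans (dvd_mockTerm_sub _ _)) ?_
    exact hd.trans (neg_dvd.1 (dvd_mockTerm_sub (-X ^ (2 * N)) n))
  have h2 := X_pow_dvd_expandTwo (X_pow_dvd_theta_sub K)
  convert! dvd_sub h1 h2 using 1
  have e2 : expandTwo (∑ n ∈ Finset.range (K + 1), (X : PowerSeries ℤ) ^ (n ^ 2)) =
      ∑ n ∈ Finset.range (K + 1), X ^ (2 * n ^ 2) := by
    rw [map_sum]
    exact Finset.sum_congr rfl fun n _ => by rw [map_pow, expand_X, ← pow_mul]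
  rw [map_sub, map_sub, map_mul, e2, map_one, map_ofNat]
  ring

theorem X_pow_dvd_prod_mul_v0Even (M : ℕ) :
    X ^ M ∣ expandTwo (∏ i ∈ Finset.range M, (1 - X ^ (2 * i + 1))) * v0Even -
      expandTwo (∏ i ∈ Finset.range M, (1 + X ^ (2 * i + 1))) * expandTwo theta := by
  have e1 : expandTwo (∏ i ∈ Finset.range M, (1 - (X : PowerSeries ℤ) ^ (2 * i + 1))) =
      ∏ i ∈ Finset.range M, (1 - X ^ (4 * i + 2)) := by
    rw [map_prod]
    refine Finset.prod_congr rfl fun i _ => ?_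
    rw [map_sub, map_one, map_pow, expand_X]
    ring
  have e2 : expandTwo (∏ i ∈ Finset.range M, (1 + (X : PowerSeries ℤ) ^ (2 * i + 1))) =
      ∏ i ∈ Finset.range M, (1 + X ^ (4 * i + 2)) := by
    rw [map_prod]
    refine Finset.prod_congr rfl fun i _ => ?_
    rw [map_add, map_one, map_pow, expand_X]
    ring
  rw [e1, e2]
  obtain ⟨a, ha⟩ := mockSum_pow_dvd M M
  obtain ⟨b, hb⟩ := X_pow_dvd_v0Even_sub M
  obtain ⟨c, hc⟩ := X_pow_dvd_mockSum_sub M M le_rfl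
  refine ⟨a + (∏ i ∈ Finset.range M, (1 - X ^ (4 * i + 2))) * b +
    (∏ i ∈ Finset.range M, (1 + X ^ (4 * i + 2))) * c, ?_⟩
  linear_combination ha + (∏ i ∈ Finset.range M, (1 - X ^ (4 * i + 2))) * hb +
    (∏ i ∈ Finset.range M, (1 + X ^ (4 * i + 2))) * hc

/-- Gauss's product formula for `φ(q)`, truncated. -/
theorem X_pow_dvd_gauss_product (M : ℕ) :
    X ^ M ∣ (∏ i ∈ Finset.range M, (1 + X ^ (2 * i + 1))) *
        (∏ i ∈ Finset.range M, (1 - X ^ (2 * i + 2))) -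
      (∏ i ∈ Finset.range M, (1 - X ^ (2 * i + 1))) *
        (∏ i ∈ Finset.range M, (1 + X ^ (2 * i + 2))) * theta := by
  have h1 : X ^ M ∣ thetaPartial M (X ^ (2 * M)) -
      (2 * ∑ n ∈ Finset.range (M + 1), X ^ (n ^ 2) - 1) := by
    have e : thetaPartial M (X ^ (2 * M)) - (2 * ∑ n ∈ Finset.range (M + 1), X ^ (n ^ 2) - 1) =
        2 * ∑ n ∈ Finset.range (M + 1), (gaussTerm (X ^ (2 * M)) n - X ^ (n ^ 2)) := by
      rw [thetaPartial, Finset.sum_sub_distrib]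
      ring
    rw [e]
    have hd : (X : PowerSeries ℤ) ^ M ∣ X ^ (2 * M) := pow_dvd_pow _ (by omega)
    exact Dvd.dvd.mul_left (Finset.dvd_sum fun n _ => hd.trans (dvd_gaussTerm_sub _ _)) _
  obtain ⟨a, ha⟩ := thetaPartial_pow_dvd M M
  obtain ⟨b, hb⟩ := h1
  obtain ⟨c, hc⟩ := X_pow_dvd_theta_sub M
  rw [Finset.prod_mul_distrib, Finset.prod_mul_distrib] at ha
  refine ⟨a + ((∏ i ∈ Finset.range M, (1 - X ^ (2 * i + 1))) *
        (∏ i ∈ Finset.range M, (1 + X ^ (2 * i + 2)))) * (b - c), ?_⟩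
  linear_combination ha + ((∏ i ∈ Finset.range M, (1 - X ^ (2 * i + 1))) *
        (∏ i ∈ Finset.range M, (1 + X ^ (2 * i + 2)))) * (hb - hc)

theorem X_pow_dvd_gauss_product_neg (M : ℕ) :
    X ^ M ∣ (∏ i ∈ Finset.range M, (1 - X ^ (2 * i + 1))) *
        (∏ i ∈ Finset.range M, (1 - X ^ (2 * i + 2))) -
      (∏ i ∈ Finset.range M, (1 + X ^ (2 * i + 1))) *
        (∏ i ∈ Finset.range M, (1 + X ^ (2 * i + 2))) * thetaNeg := by
  have h := X_pow_dvd_evalNegHom (X_pow_dvd_gauss_product M)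
  have e1 : evalNegHom (∏ i ∈ Finset.range M, (1 - (X : PowerSeries ℤ) ^ (2 * i + 2))) =
      ∏ i ∈ Finset.range M, (1 - X ^ (2 * i + 2)) := by
    rw [map_prod]
    exact Finset.prod_congr rfl fun i _ => by
      rw [map_sub, map_one, evalNegHom_X_pow_even]
  have e2 : evalNegHom (∏ i ∈ Finset.range M, (1 + (X : PowerSeries ℤ) ^ (2 * i + 2))) =
      ∏ i ∈ Finset.range M, (1 + X ^ (2 * i + 2)) := by
    rw [map_prod]
    exact Finset.prod_congr rfl fun i _ => by
      rw [map_add, map_one, evalNegHom_X_pow_even]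
  rwa [map_sub, map_mul, map_mul, map_mul, evalNegHom_prod_sub, evalNegHom_prod_add, e1, e2,
    ← thetaNeg] at h

theorem dvd_of_dvd_mul_of_constantCoeff {d u f : PowerSeries ℤ} (hu : constantCoeff u = 1)
    (h : d ∣ u * f) : d ∣ f := by
  have h1 := Dvd.dvd.mul_left h (unitInv u)
  rwa [← mul_assoc, mul_comm (unitInv u), mul_unitInv hu, one_mul] at h1

theorem constantCoeff_expandTwo (f : PowerSeries ℤ) :
    constantCoeff (expandTwo f) = constantCoeff f := constantCoeff_expand _ _ _

theorem constantCoeff_expandFour (f : PowerSeries ℤ) :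
    constantCoeff (expandFour f) = constantCoeff f := constantCoeff_expand _ _ _

/-- Squaring the product formula for V allows the infinite products to be eliminated against Gauss's
products for φ(q²) and φ(-q²). Everything is done with truncations modulo q^M, after multiplying by
a unit. -/
theorem v0Even_sq_mul : v0Even ^ 2 * expandTwo thetaNeg = expandTwo theta ^ 3 := by
  refine eq_of_forall_X_pow_dvd_sub fun M => ?_
  obtain ⟨r, hr⟩ := X_pow_dvd_prod_mul_v0Even M
  obtain ⟨s, hs⟩ := X_pow_dvd_expandTwo (X_pow_dvd_gauss_product M)
  obtain ⟨t, ht⟩ := X_pow_dvd_expandTwo (X_pow_dvd_gauss_product_neg M)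
  rw [map_sub, map_mul, map_mul, map_mul] at hs ht
  set a := expandTwo (∏ i ∈ Finset.range M, (1 + (X : PowerSeries ℤ) ^ (2 * i + 1))) with ha
  set b := expandTwo (∏ i ∈ Finset.range M, (1 - (X : PowerSeries ℤ) ^ (2 * i + 1))) with hb
  set P := expandTwo (∏ i ∈ Finset.range M, (1 + (X : PowerSeries ℤ) ^ (2 * i + 2))) with hP
  set Q := expandTwo (∏ i ∈ Finset.range M, (1 - (X : PowerSeries ℤ) ^ (2 * i + 2)))
  have hu : constantCoeff (a * P * b ^ 2) = 1 := by
    rw [map_mul, map_mul, map_pow, ha, hb, hP]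
    simp [map_prod]
  refine dvd_of_dvd_mul_of_constantCoeff hu
    ⟨-(v0Even ^ 2 * b ^ 2 * t) + b * Q * (b * v0Even + a * expandTwo theta) * r +
      a * b * expandTwo theta ^ 2 * s, ?_⟩
  linear_combination -(v0Even ^ 2 * b ^ 2) * ht +
    b * Q * (b * v0Even + a * expandTwo theta) * hr + a * b * expandTwo theta ^ 2 * hs

theorem v0_zero : v0 0 = 1 := by
  simp [v0, v0Term, qPochhammer]

theorem coeff_v0Even_two_mul (m : ℕ) :
    coeff (2 * m) v0Even = 2 * v0 (2 * m) - if m = 0 then 1 else 0 := by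
  rw [v0Even, map_sub, map_add, coeff_evalNegHom, coeff_mk, coeff_one,
    Even.neg_one_pow ⟨m, by ring⟩]
  have : 2 * m = 0 ↔ m = 0 := by omega
  simp only [this]
  ring

theorem v0Even_mul : v0Even * expandFour thetaNeg = expandTwo (theta ^ 2) := by
  have h : (v0Even * expandFour thetaNeg) ^ 2 = expandTwo (theta ^ 2) ^ 2 := by
    have h1 := congrArg expandTwo theta_mul_thetaNeg
    rw [expandTwo_expandTwo, map_mul, map_pow] at h1
    rw [mul_pow, ← h1, map_pow]
    linear_combination expandTwo theta * v0Even_sq_mul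
  -- The sign of the square root is fixed by the constant coefficients, both equal to 1.
  rcases sq_eq_sq_iff_eq_or_eq_neg.1 h with h | h
  · exact h
  · exfalso
    have h2 := congrArg constantCoeff h
    have h3 := coeff_v0Even_two_mul 0
    rw [mul_zero, coeff_zero_eq_constantCoeff_apply, v0_zero] at h3
    rw [map_mul, map_neg, constantCoeff_expandFour, constantCoeff_expandTwo, map_pow,
      constantCoeff_theta, constantCoeff_thetaNeg, h3] at h2
    norm_num at h2

/-! ### The operator `U₄` -/

/-- The operator `∑ a_n q^n ↦ ∑ a_{4n} q^n`. -/
noncomputable def uFour : PowerSeries ℤ →+ PowerSeries ℤ where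
  toFun f := mk fun n => coeff (4 * n) f
  map_zero' := by ext n; simp
  map_add' f g := by ext n; simp

theorem coeff_uFour (f : PowerSeries ℤ) (n : ℕ) : coeff n (uFour f) = coeff (4 * n) f := by
  simp [uFour]

theorem uFour_expandFour_mul (f g : PowerSeries ℤ) :
    uFour (expandFour f * g) = f * uFour g := by
  ext n
  rw [coeff_uFour, coeff_mul, coeff_mul]
  symm
  refine Finset.sum_of_injOn (fun p => (4 * p.1, 4 * p.2)) ?_ ?_ ?_ ?_
  · rintro ⟨a, b⟩ _ ⟨c, d⟩ _ h
    simp only [Prod.mk.injEq] at h ⊢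
    omega
  · rintro ⟨a, b⟩ h
    simp only [Finset.mem_coe, Finset.HasAntidiagonal.mem_antidiagonal] at h ⊢
    omega
  · rintro ⟨a, b⟩ h h'
    rw [Finset.HasAntidiagonal.mem_antidiagonal] at h
    rw [coeff_expand_of_not_dvd, zero_mul]
    rintro ⟨c, rfl⟩
    refine h' ⟨(c, n - c), ?_, ?_⟩
    · simp only [Finset.mem_coe, Finset.HasAntidiagonal.mem_antidiagonal]
      omega
    · simp only [Prod.mk.injEq, true_and]
      omega
  · rintro ⟨a, b⟩ _
    rw [coeff_expandFour_mul, coeff_uFour]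

theorem uFour_expandFour (f : PowerSeries ℤ) : uFour (expandFour f) = f := by
  ext n
  rw [coeff_uFour, coeff_expandFour_mul]

theorem SupportedMod.uFour_eq_zero {r : ℕ} {f : PowerSeries ℤ} (hf : SupportedMod 4 r f)
    (hr : r % 4 ≠ 0) : uFour f = 0 := by
  ext n
  rw [coeff_uFour, hf.coeff_eq_zero (by omega), map_zero]

theorem coeff_uFour_iterate (k n : ℕ) (f : PowerSeries ℤ) :
    coeff n (uFour^[k] f) = coeff (4 ^ k * n) f := by
  induction k generalizing n with
  | zero => simp
  | succ k ih => rw [Function.iterate_succ_apply', coeff_uFour, ih, pow_succ, mul_assoc]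

theorem thetaNeg_mul_uFour_v0Even : thetaNeg * uFour v0Even = theta ^ 2 := by
  rw [← uFour_expandFour_mul, mul_comm, v0Even_mul]
  ext n
  rw [coeff_uFour, show 4 * n = 2 * (2 * n) by ring, coeff_expandTwo_mul, coeff_two_mul_theta_sq]

/-! ### Modular functions in terms of the quotient of theta series -/

/-- `τ = (∑_{n odd, n > 0} q^{n^2}) / φ(q^4)`. -/
noncomputable def tau : PowerSeries ℤ := oddTheta * expandFour (unitInv theta)

/-- The function `(φ(q) / φ(-q))^4`. -/
noncomputable def hauptY : PowerSeries ℤ := (theta * unitInv thetaNeg) ^ 4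

/-- The function `(φ(-q) / φ(q))^4`. -/
noncomputable def hauptYInv : PowerSeries ℤ := (thetaNeg * unitInv theta) ^ 4

/-- The function `((φ(q) / φ(-q))^4 - 1) / 16`. -/
noncomputable def hauptW : PowerSeries ℤ :=
  tau * (1 + 4 * tau ^ 2) * (expandFour theta * unitInv thetaNeg) ^ 4

theorem theta_mul_unitInv : theta * unitInv theta = 1 := mul_unitInv constantCoeff_theta

theorem thetaNeg_mul_unitInv : thetaNeg * unitInv thetaNeg = 1 :=
  mul_unitInv constantCoeff_thetaNeg

theorem expandFour_theta_mul_unitInv : expandFour theta * expandFour (unitInv theta) = 1 := by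
  rw [← map_mul, theta_mul_unitInv, map_one]

theorem expandFour_theta_mul_tau : expandFour theta * tau = oddTheta := by
  rw [tau]
  linear_combination oddTheta * expandFour_theta_mul_unitInv

theorem theta_eq_mul : theta = expandFour theta * (1 + 2 * tau) := by
  linear_combination theta_eq_add - 2 * expandFour_theta_mul_tau

theorem thetaNeg_eq_mul : thetaNeg = expandFour theta * (1 - 2 * tau) := by
  linear_combination thetaNeg_eq_sub + 2 * expandFour_theta_mul_tau

theorem hauptY_mul_hauptYInv : hauptY * hauptYInv = 1 := by
  rw [hauptY, hauptYInv, ← mul_pow]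
  have : theta * unitInv thetaNeg * (thetaNeg * unitInv theta) = 1 := by
    linear_combination theta_mul_unitInv * (thetaNeg * unitInv thetaNeg) + thetaNeg_mul_unitInv
  rw [this, one_pow]

theorem expandFour_mul_one_sub : expandFour theta * unitInv thetaNeg * (1 - 2 * tau) = 1 := by
  linear_combination thetaNeg_mul_unitInv - unitInv thetaNeg * thetaNeg_eq_mul

theorem hauptY_eq : hauptY = 1 + 16 * hauptW := by
  have h1 : theta * unitInv thetaNeg =
      expandFour theta * unitInv thetaNeg * (1 + 2 * tau) := by
    linear_combination unitInv thetaNeg * theta_eq_mul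
  have h2 : (expandFour theta * unitInv thetaNeg) ^ 4 * (1 - 2 * tau) ^ 4 = 1 := by
    rw [← mul_pow, expandFour_mul_one_sub, one_pow]
  rw [hauptY, hauptW, h1]
  linear_combination h2

theorem one_sub_tau_pow_four : 1 - 16 * tau ^ 4 = expandFour hauptYInv := by
  have h : (expandFour theta * expandFour (unitInv theta)) ^ 4 = 1 := by
    rw [expandFour_theta_mul_unitInv, one_pow]
  rw [hauptYInv, mul_pow, map_mul, ← expandFour_theta_pow_four_sub, tau, map_pow]
  linear_combination -h

theorem sixteen_ne_zero : (16 : PowerSeries ℤ) ≠ 0 := by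
  intro h
  have := congrArg constantCoeff h
  rw [map_ofNat, map_zero] at this
  norm_num at this

theorem tau_pow_four : tau ^ 4 = expandFour (hauptW * hauptYInv) := by
  apply mul_left_cancel₀ sixteen_ne_zero
  have h : 16 * (hauptW * hauptYInv) = 1 - hauptYInv := by
    linear_combination hauptY_mul_hauptYInv - hauptYInv * hauptY_eq
  have h2 := congrArg expandFour h
  rw [map_mul, map_ofNat, map_sub, map_one] at h2
  linear_combination -h2 - one_sub_tau_pow_four

theorem two_tau_pow_four : (2 * tau) ^ 4 = expandFour (1 - hauptYInv) := by
  rw [map_sub, map_one]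
  linear_combination -one_sub_tau_pow_four

theorem expandFour_hauptY_mul : (1 - (2 * tau) ^ 4) * expandFour hauptY = 1 := by
  rw [two_tau_pow_four, map_sub, map_one, sub_sub_cancel, ← map_mul, mul_comm,
    hauptY_mul_hauptYInv, map_one]

/-- With t = 2τ, 1/(1 - t) = (1 + t)(1 + t²)/(1 - t⁴) moves the denominator into a series in q⁴. -/
theorem expandFour_theta_mul_unitInv_thetaNeg : expandFour theta * unitInv thetaNeg =
    (1 + 2 * tau) * (1 + (2 * tau) ^ 2) * expandFour hauptY := by
  linear_combination ((1 + 2 * tau) * (1 + (2 * tau) ^ 2) * expandFour hauptY) *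
    expandFour_mul_one_sub - (expandFour theta * unitInv thetaNeg) * expandFour_hauptY_mul

theorem expandFour_theta_mul_thetaNeg : expandFour theta * unitInv theta =
    (1 - 2 * tau) * (1 + (2 * tau) ^ 2) * expandFour hauptY := by
  have h : expandFour theta * unitInv theta * (1 + 2 * tau) = 1 := by
    linear_combination theta_mul_unitInv - unitInv theta * theta_eq_mul
  linear_combination ((1 - 2 * tau) * (1 + (2 * tau) ^ 2) * expandFour hauptY) * h -
    (expandFour theta * unitInv theta) * expandFour_hauptY_mul

/-! ### Rings of modular functions and the action of U₄ on them -/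

/-- The ring of polynomials in `(φ(q) / φ(-q))^4` and its inverse. -/
noncomputable def hauptRing : Subring (PowerSeries ℤ) := Subring.closure {hauptY, hauptYInv}

theorem hauptY_mem : hauptY ∈ hauptRing := Subring.subset_closure (by simp)

theorem hauptYInv_mem : hauptYInv ∈ hauptRing := Subring.subset_closure (by simp)

/-- The ring of polynomials in `2 τ` with coefficients in `hauptRing` evaluated at `q^4`. -/
noncomputable def tauRing : Subring (PowerSeries ℤ) where
  carrier := {f | ∃ a ∈ hauptRing, ∃ b ∈ hauptRing, ∃ c ∈ hauptRing, ∃ d ∈ hauptRing,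
    f = expandFour a + expandFour b * (2 * tau) + expandFour c * (2 * tau) ^ 2 +
      expandFour d * (2 * tau) ^ 3}
  zero_mem' := ⟨0, zero_mem _, 0, zero_mem _, 0, zero_mem _, 0, zero_mem _, by simp⟩
  one_mem' := ⟨1, one_mem _, 0, zero_mem _, 0, zero_mem _, 0, zero_mem _, by simp⟩
  add_mem' := by
    rintro _ _ ⟨a, ha, b, hb, c, hc, d, hd, rfl⟩ ⟨a', ha', b', hb', c', hc', d', hd', rfl⟩
    refine ⟨a + a', add_mem ha ha', b + b', add_mem hb hb', c + c', add_mem hc hc',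
      d + d', add_mem hd hd', ?_⟩
    simp only [map_add]
    ring
  neg_mem' := by
    rintro _ ⟨a, ha, b, hb, c, hc, d, hd, rfl⟩
    refine ⟨-a, neg_mem ha, -b, neg_mem hb, -c, neg_mem hc, -d, neg_mem hd, ?_⟩
    simp only [map_neg]
    ring
  mul_mem' := by
    rintro _ _ ⟨a, ha, b, hb, c, hc, d, hd, rfl⟩ ⟨a', ha', b', hb', c', hc', d', hd', rfl⟩
    have hl : 1 - hauptYInv ∈ hauptRing := sub_mem (one_mem _) hauptYInv_mem
    refine ⟨a * a' + (1 - hauptYInv) * (b * d' + c * c' + d * b'),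
      add_mem (mul_mem ha ha') (mul_mem hl (add_mem (add_mem (mul_mem hb hd') (mul_mem hc hc'))
        (mul_mem hd hb'))),
      a * b' + b * a' + (1 - hauptYInv) * (c * d' + d * c'),
      add_mem (add_mem (mul_mem ha hb') (mul_mem hb ha')) (mul_mem hl (add_mem (mul_mem hc hd')
        (mul_mem hd hc'))),
      a * c' + b * b' + c * a' + (1 - hauptYInv) * (d * d'),
      add_mem (add_mem (add_mem (mul_mem ha hc') (mul_mem hb hb')) (mul_mem hc ha'))
        (mul_mem hl (mul_mem hd hd')),
      a * d' + b * c' + c * b' + d * a',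
      add_mem (add_mem (add_mem (mul_mem ha hd') (mul_mem hb hc')) (mul_mem hc hb'))
        (mul_mem hd ha'), ?_⟩
    have h := two_tau_pow_four
    simp only [map_add, map_mul (expandFour)]
    linear_combination (expandFour b * expandFour d' + expandFour c * expandFour c' +
      expandFour d * expandFour b' + (expandFour c * expandFour d' +
      expandFour d * expandFour c') * (2 * tau) +
      expandFour d * expandFour d' * (2 * tau) ^ 2) * h

theorem expandFour_mem_tauRing {a : PowerSeries ℤ} (ha : a ∈ hauptRing) :
    expandFour a ∈ tauRing :=
  ⟨a, ha, 0, zero_mem _, 0, zero_mem _, 0, zero_mem _, by simp⟩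

theorem two_tau_mem : 2 * tau ∈ tauRing :=
  ⟨0, zero_mem _, 1, one_mem _, 0, zero_mem _, 0, zero_mem _, by simp⟩

theorem one_add_two_tau_sq_mem : 1 + (2 * tau) ^ 2 ∈ tauRing :=
  add_mem (one_mem _) (pow_mem two_tau_mem 2)

theorem expandFour_theta_mul_unitInv_thetaNeg_mem :
    expandFour theta * unitInv thetaNeg ∈ tauRing := by
  rw [expandFour_theta_mul_unitInv_thetaNeg]
  exact mul_mem (mul_mem (add_mem (one_mem _) two_tau_mem) one_add_two_tau_sq_mem)
    (expandFour_mem_tauRing hauptY_mem)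

/-- This closes the loop: what U₄ produces can be re-expanded in 2τ over series in q⁴, so U₄ can be
applied again. -/
theorem hauptRing_le_tauRing : hauptRing ≤ tauRing := by
  refine Subring.closure_le.2 ?_
  rintro f (rfl | rfl)
  · have h1 : theta * unitInv thetaNeg =
        expandFour theta * unitInv thetaNeg * (1 + 2 * tau) := by
      linear_combination unitInv thetaNeg * theta_eq_mul
    rw [hauptY, h1]
    exact pow_mem (mul_mem expandFour_theta_mul_unitInv_thetaNeg_mem
      (add_mem (one_mem _) two_tau_mem)) 4
  · have h1 : thetaNeg * unitInv theta =
        expandFour theta * unitInv theta * (1 - 2 * tau) := by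
      linear_combination unitInv theta * thetaNeg_eq_mul
    rw [hauptYInv, h1, expandFour_theta_mul_thetaNeg]
    exact pow_mem (mul_mem (mul_mem (mul_mem (sub_mem (one_mem _) two_tau_mem)
      one_add_two_tau_sq_mem) (expandFour_mem_tauRing hauptY_mem))
      (sub_mem (one_mem _) two_tau_mem)) 4

theorem supportedMod_tau : SupportedMod 4 1 tau :=
  (supportedMod_oddTheta.of_dvd (by norm_num)).mul (supportedMod_expandFour _)

theorem uFour_tau_pow {k : ℕ} (hk : k % 4 ≠ 0) : uFour (tau ^ k) = 0 :=
  (supportedMod_tau.pow k).uFour_eq_zero (by omega)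

theorem uFour_two_mul (f : PowerSeries ℤ) : uFour (2 * f) = 2 * uFour f := by
  rw [two_mul, map_add, two_mul]

/-- Of the powers τ, τ², τ³, τ⁴ that occur, only τ⁴ survives U₄, and it carries the coefficient 2³.
-/
theorem uFour_tau_mul {f : PowerSeries ℤ} (hf : f ∈ tauRing) :
    ∃ d ∈ hauptRing, uFour (tau * f) = 8 * hauptW * d := by
  obtain ⟨a, _, b, _, c, _, d, hd, rfl⟩ := hf
  refine ⟨hauptYInv * d, mul_mem hauptYInv_mem hd, ?_⟩
  have e : tau * (expandFour a + expandFour b * (2 * tau) + expandFour c * (2 * tau) ^ 2 +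
      expandFour d * (2 * tau) ^ 3) = expandFour a * tau ^ 1 + expandFour (2 * b) * tau ^ 2 +
      expandFour (4 * c) * tau ^ 3 + expandFour (8 * d * (hauptW * hauptYInv)) * 1 := by
    rw [map_mul expandFour 2, map_mul expandFour 4, map_mul expandFour (8 * d),
      map_mul expandFour 8, map_ofNat, map_ofNat, map_ofNat, ← tau_pow_four]
    ring
  rw [e, map_add, map_add, map_add, uFour_expandFour_mul, uFour_expandFour_mul,
    uFour_expandFour_mul, mul_one, uFour_expandFour, uFour_tau_pow (by norm_num),
    uFour_tau_pow (by norm_num), uFour_tau_pow (by norm_num)]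
  ring

/-- `U₄` gains a factor `8` on the module spanned by `φ(q) w`. -/
theorem uFour_theta_mul_hauptW_mul {s : PowerSeries ℤ} (hs : s ∈ hauptRing) :
    ∃ s' ∈ hauptRing, uFour (theta * hauptW * s) = 8 * (theta * hauptW * s') := by
  have hg : (1 + 2 * tau) * (1 + (2 * tau) ^ 2) * (expandFour theta * unitInv thetaNeg) ^ 4 * s ∈
      tauRing :=
    mul_mem (mul_mem (mul_mem (add_mem (one_mem _) two_tau_mem) one_add_two_tau_sq_mem)
      (pow_mem expandFour_theta_mul_unitInv_thetaNeg_mem 4)) (hauptRing_le_tauRing hs)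
  obtain ⟨d, hd, h⟩ := uFour_tau_mul hg
  refine ⟨d, hd, ?_⟩
  have e : theta * hauptW * s = expandFour theta * (tau * ((1 + 2 * tau) * (1 + (2 * tau) ^ 2) *
      (expandFour theta * unitInv thetaNeg) ^ 4 * s)) := by
    rw [hauptW]
    linear_combination (tau * (1 + 4 * tau ^ 2) *
      (expandFour theta * unitInv thetaNeg) ^ 4 * s) * theta_eq_mul
  rw [e, uFour_expandFour_mul, h]
  ring

theorem uFour_theta : uFour theta = theta := by
  conv_lhs => rw [theta_eq_add]
  rw [map_add, uFour_expandFour, uFour_two_mul, (supportedMod_oddTheta.of_dvd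
    (show 4 ∣ 8 by norm_num)).uFour_eq_zero (by norm_num), mul_zero, add_zero]

theorem uFour_v0Even : uFour v0Even = theta ^ 2 * unitInv thetaNeg := by
  linear_combination unitInv thetaNeg * thetaNeg_mul_uFour_v0Even -
    uFour v0Even * thetaNeg_mul_unitInv

theorem theta_sq_mul_unitInv : theta ^ 2 * unitInv thetaNeg =
    expandFour theta * (1 + 2 * tau) ^ 2 * (expandFour theta * unitInv thetaNeg) := by
  linear_combination unitInv thetaNeg * (theta + expandFour theta * (1 + 2 * tau)) * theta_eq_mul

theorem uFour_uFour_v0Even : uFour (uFour v0Even) = theta + 64 * (theta * hauptW) := by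
  -- With t = 2τ this is (1 + t)³(1 + t²) = 1 + 3t + 4t² + 4t³ + 3t⁴ + t⁵, where t⁴ is replaced by
  -- its value as a series in q⁴.
  have e : theta ^ 2 * unitInv thetaNeg = expandFour (theta * hauptY) *
      (expandFour (1 + 3 * (1 - hauptYInv)) * 1 + expandFour (2 * (3 + (1 - hauptYInv))) * tau ^ 1 +
        expandFour 16 * tau ^ 2 + expandFour 32 * tau ^ 3) := by
    have h := two_tau_pow_four
    rw [theta_sq_mul_unitInv, expandFour_theta_mul_unitInv_thetaNeg]
    simp only [map_add, map_mul, map_ofNat, map_one, ← h]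
    ring
  have h1 : uFour 1 = 1 := by simpa using uFour_expandFour 1
  rw [uFour_v0Even, e, uFour_expandFour_mul, map_add, map_add, map_add, uFour_expandFour_mul,
    uFour_expandFour_mul, uFour_expandFour_mul, uFour_expandFour_mul, h1,
    uFour_tau_pow (by norm_num), uFour_tau_pow (by norm_num), uFour_tau_pow (by norm_num)]
  linear_combination -3 * theta * hauptY_mul_hauptYInv + 4 * theta * hauptY_eq

theorem uFour_iterate_v0Even (k : ℕ) : ∃ s ∈ hauptRing,
    uFour^[k + 2] v0Even = theta + 64 * 8 ^ k * (theta * hauptW * s) := by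
  induction k with
  | zero =>
    refine ⟨1, one_mem _, ?_⟩
    rw [zero_add, Function.iterate_succ_apply', Function.iterate_one, uFour_uFour_v0Even]
    ring
  | succ k ih =>
    obtain ⟨s, hs, h⟩ := ih
    obtain ⟨s', hs', h'⟩ := uFour_theta_mul_hauptW_mul hs
    refine ⟨s', hs', ?_⟩
    -- Viewing the scalar as a series in q⁴ lets it pass through U₄.
    have e : (64 * 8 ^ k : PowerSeries ℤ) = expandFour (64 * 8 ^ k) := by
      rw [map_mul, map_pow, map_ofNat, map_ofNat]
    rw [show k + 1 + 2 = k + 2 + 1 by ring, Function.iterate_succ_apply', h, map_add,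
      uFour_theta, e, uFour_expandFour_mul, h']
    ring

/-! ### Congruences modulo powers of two -/

theorem coeff_intCast_mul (k : ℤ) (f : PowerSeries ℤ) (n : ℕ) :
    coeff n ((k : PowerSeries ℤ) * f) = k * coeff n f := by
  rw [← zsmul_eq_mul, map_zsmul, smul_eq_mul]

theorem exists_eq_one_add_two_mul : ∃ f, theta = 1 + 2 * f := by
  refine ⟨mk fun n => if n = 0 then 0 else if IsSquare n then 1 else 0, ?_⟩
  ext n
  rw [map_add, coeff_two_mul, coeff_one, coeff_mk, theta, coeff_mk]
  split_ifs <;> norm_num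

theorem exists_unitInv_theta_sq : ∃ f, expandFour (unitInv theta) ^ 2 = 1 + 4 * f := by
  obtain ⟨f, hf⟩ := exists_eq_one_add_two_mul
  refine ⟨expandFour (-(f * unitInv theta) + (f * unitInv theta) ^ 2), ?_⟩
  have h : unitInv theta = 1 - 2 * (f * unitInv theta) := by
    linear_combination theta_mul_unitInv - unitInv theta * hf
  have h2 : unitInv theta ^ 2 = 1 + 4 * (-(f * unitInv theta) + (f * unitInv theta) ^ 2) := by
    linear_combination (unitInv theta + (1 - 2 * (f * unitInv theta))) * h
  rw [← map_pow, h2, map_add, map_mul, map_one, map_ofNat]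

/-- Modulo 16, (1 - 2τ)^{-4} is 1 + 8τ + 8τ²; κ is the exact remainder divided by 16. -/
theorem theta_mul_hauptW_eq : ∃ f, theta * hauptW =
    oddTheta + 10 * (oddTheta * tau) + 12 * (oddTheta * tau ^ 2) + 8 * (oddTheta * tau ^ 3) +
      16 * f := by
  set v := expandFour theta * unitInv thetaNeg with hv
  have h1 : v * (1 - 2 * tau) = 1 := expandFour_mul_one_sub
  have h4 : v ^ 4 * (1 - 2 * tau) ^ 4 = 1 := by rw [← mul_pow, h1, one_pow]
  set κ := v ^ 4 * (2 * tau ^ 2 - 6 * tau ^ 3 + 3 * tau ^ 4 + 8 * tau ^ 5 - 8 * tau ^ 6)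
  have h5 : v ^ 4 = 1 + 8 * tau + 8 * tau ^ 2 + 16 * κ := by
    linear_combination (1 + 8 * tau + 8 * tau ^ 2) * h4
  have h6 : theta * hauptW = oddTheta * ((1 + 2 * tau) * (1 + 4 * tau ^ 2) * v ^ 4) := by
    rw [hauptW, ← hv]
    linear_combination (tau * (1 + 4 * tau ^ 2) * v ^ 4) * theta_eq_mul +
      (1 + 2 * tau) * (1 + 4 * tau ^ 2) * v ^ 4 * expandFour_theta_mul_tau
  rw [h6, h5]
  refine ⟨oddTheta * (tau ^ 2 + 3 * tau ^ 3 + 6 * tau ^ 4 + 4 * tau ^ 5 +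
    (1 + 2 * tau) * (1 + 4 * tau ^ 2) * κ), ?_⟩
  ring

/-- 1/φ(q⁴)² ≡ 1 mod 4, so modulo 4 the term is a cube of a series on exponents 1 mod 8, hence
supported on 3 mod 8. This separates 7 from 3 mod 8. -/
theorem oddTheta_mul_tau_sq_eq : ∃ f, oddTheta * tau ^ 2 = oddTheta ^ 3 + 4 * f := by
  obtain ⟨f, hf⟩ := exists_unitInv_theta_sq
  refine ⟨oddTheta ^ 3 * f, ?_⟩
  rw [tau, mul_pow, hf]
  ring

theorem supportedMod_four_oddTheta : SupportedMod 4 1 oddTheta :=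
  supportedMod_oddTheta.of_dvd (by norm_num)

theorem supportedMod_oddTheta_mul_tau_pow (k : ℕ) :
    SupportedMod 4 (1 + k * 1) (oddTheta * tau ^ k) :=
  supportedMod_four_oddTheta.mul (supportedMod_tau.pow k)

theorem four_dvd_coeff_oddTheta_mul_tau_sq {m : ℕ} (hm : m % 8 ≠ 3) :
    4 ∣ coeff m (oddTheta * tau ^ 2) := by
  obtain ⟨f, hf⟩ := oddTheta_mul_tau_sq_eq
  refine ⟨coeff m f, ?_⟩
  have h := coeff_intCast_mul 4 f m
  push_cast at h
  rw [hf, map_add, (supportedMod_oddTheta.pow 3).coeff_eq_zero (by omega), h, zero_add]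

theorem coeff_theta_mul_hauptW_eq (m : ℕ) : ∃ c : ℤ, coeff m (theta * hauptW) =
    coeff m oddTheta + 10 * coeff m (oddTheta * tau ^ 1) + 12 * coeff m (oddTheta * tau ^ 2) +
      8 * coeff m (oddTheta * tau ^ 3) + 16 * c := by
  obtain ⟨f, hf⟩ := theta_mul_hauptW_eq
  refine ⟨coeff m f, ?_⟩
  have h10 := coeff_intCast_mul 10 (oddTheta * tau) m
  have h12 := coeff_intCast_mul 12 (oddTheta * tau ^ 2) m
  have h8 := coeff_intCast_mul 8 (oddTheta * tau ^ 3) m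
  have h16 := coeff_intCast_mul 16 f m
  push_cast at h10 h12 h8 h16
  rw [hf, map_add, map_add, map_add, map_add, h10, h12, h8, h16, pow_one]

/-- Both generators are 1 mod 16, so the unknown factor s acts on coefficients mod 16 as an integer.
-/
theorem exists_eq_intCast_add {s : PowerSeries ℤ} (hs : s ∈ hauptRing) :
    ∃ (c : ℤ) (f : PowerSeries ℤ), s = c + 16 * f := by
  induction hs using Subring.closure_induction with
  | mem x hx =>
    rcases hx with rfl | rfl
    · exact ⟨1, hauptW, by rw [hauptY_eq]; push_cast; ring⟩
    · refine ⟨1, -(hauptW * hauptYInv), ?_⟩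
      push_cast
      linear_combination hauptY_mul_hauptYInv - hauptYInv * hauptY_eq
  | zero => exact ⟨0, 0, by simp⟩
  | one => exact ⟨1, 0, by simp⟩
  | add x y _ _ hx hy =>
    obtain ⟨c, f, rfl⟩ := hx
    obtain ⟨d, g, rfl⟩ := hy
    exact ⟨c + d, f + g, by push_cast; ring⟩
  | neg x _ hx =>
    obtain ⟨c, f, rfl⟩ := hx
    exact ⟨-c, -f, by push_cast; ring⟩
  | mul x y _ _ hx hy =>
    obtain ⟨c, f, rfl⟩ := hx
    obtain ⟨d, g, rfl⟩ := hy
    exact ⟨c * d, c * g + d * f + 16 * (f * g), by push_cast; ring⟩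

theorem coeff_theta_mul_hauptW_mul {s : PowerSeries ℤ} (hs : s ∈ hauptRing) (m : ℕ) :
    ∃ a b : ℤ, coeff m (theta * hauptW * s) = a * coeff m (theta * hauptW) + 16 * b := by
  obtain ⟨c, f, rfl⟩ := exists_eq_intCast_add hs
  refine ⟨c, coeff m (theta * hauptW * f), ?_⟩
  have h16 := coeff_intCast_mul 16 (theta * hauptW * f) m
  push_cast at h16
  rw [← h16, ← coeff_intCast_mul, ← map_add]
  ring_nf

theorem two_dvd_coeff_theta_mul_hauptW_mul {s : PowerSeries ℤ} (hs : s ∈ hauptRing) {m : ℕ}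
    (hm : m % 4 = 2) : 2 ∣ coeff m (theta * hauptW * s) := by
  obtain ⟨a, b, h⟩ := coeff_theta_mul_hauptW_mul hs m
  obtain ⟨c, h'⟩ := coeff_theta_mul_hauptW_eq m
  rw [supportedMod_oddTheta.coeff_eq_zero (by omega)] at h'
  rw [h]
  exact dvd_add (Dvd.dvd.mul_left (by omega) _) (by omega)

theorem four_dvd_coeff_theta_mul_hauptW_mul {s : PowerSeries ℤ} (hs : s ∈ hauptRing) {m : ℕ}
    (hm : m % 4 = 3) : 4 ∣ coeff m (theta * hauptW * s) := by
  obtain ⟨a, b, h⟩ := coeff_theta_mul_hauptW_mul hs m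
  obtain ⟨c, h'⟩ := coeff_theta_mul_hauptW_eq m
  rw [supportedMod_oddTheta.coeff_eq_zero (by omega),
    (supportedMod_oddTheta_mul_tau_pow 1).coeff_eq_zero (by omega)] at h'
  rw [h]
  exact dvd_add (Dvd.dvd.mul_left (by omega) _) (by omega)

/-- For m ≡ 5 mod 8 all listed terms vanish by support; for m ≡ 7 only 12 times the coefficient of
`oddTheta * tau ^ 2` is left, and that coefficient is divisible by 4. -/
theorem sixteen_dvd_coeff_theta_mul_hauptW_mul {s : PowerSeries ℤ} (hs : s ∈ hauptRing) {m : ℕ}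
    (hm : m % 8 = 5 ∨ m % 8 = 7) : 16 ∣ coeff m (theta * hauptW * s) := by
  obtain ⟨a, b, h⟩ := coeff_theta_mul_hauptW_mul hs m
  obtain ⟨c, h'⟩ := coeff_theta_mul_hauptW_eq m
  have h4 := four_dvd_coeff_oddTheta_mul_tau_sq (m := m) (by omega)
  rw [supportedMod_oddTheta.coeff_eq_zero (by omega),
    (supportedMod_oddTheta_mul_tau_pow 1).coeff_eq_zero (by omega),
    (supportedMod_oddTheta_mul_tau_pow 3).coeff_eq_zero (by omega)] at h'
  rw [h]
  exact dvd_add (Dvd.dvd.mul_left (by omega) _) (by omega)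

/-- The expansion (1 + t)²/(1 - t) = 1 + 3t + 4t² + 4t³ + 4t⁴ + 4t⁵/(1 - t) at t = 2τ. -/
theorem coeff_uFour_v0Even_eq (m : ℕ) : ∃ c : ℤ, coeff m (uFour v0Even) =
    coeff m (expandFour theta) + 6 * coeff m oddTheta + 16 * coeff m (oddTheta * tau ^ 1) +
      32 * coeff m (oddTheta * tau ^ 2) + 64 * coeff m (oddTheta * tau ^ 3) + 128 * c := by
  set v := expandFour theta * unitInv thetaNeg with hv
  have h1 : v * (1 - 2 * tau) = 1 := expandFour_mul_one_sub
  refine ⟨coeff m (oddTheta * tau ^ 4 * v), ?_⟩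
  have e : uFour v0Even = expandFour theta + 6 * oddTheta + 16 * (oddTheta * tau ^ 1) +
      32 * (oddTheta * tau ^ 2) + 64 * (oddTheta * tau ^ 3) + 128 * (oddTheta * tau ^ 4 * v) := by
    rw [uFour_v0Even, theta_sq_mul_unitInv, ← hv, ← expandFour_theta_mul_tau]
    linear_combination expandFour theta * (1 + 6 * tau + 16 * tau ^ 2 + 32 * tau ^ 3 +
      64 * tau ^ 4) * h1
  have h6 := coeff_intCast_mul 6 oddTheta m
  have h16 := coeff_intCast_mul 16 (oddTheta * tau ^ 1) m
  have h32 := coeff_intCast_mul 32 (oddTheta * tau ^ 2) m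
  have h64 := coeff_intCast_mul 64 (oddTheta * tau ^ 3) m
  have h128 := coeff_intCast_mul 128 (oddTheta * tau ^ 4 * v) m
  push_cast at h6 h16 h32 h64 h128
  rw [e, map_add, map_add, map_add, map_add, map_add, h6, h16, h32, h64, h128]

theorem sixteen_dvd_coeff_uFour_v0Even {m : ℕ} (hm : m % 4 = 2) :
    16 ∣ coeff m (uFour v0Even) := by
  obtain ⟨c, h⟩ := coeff_uFour_v0Even_eq m
  rw [(supportedMod_expandFour theta).coeff_eq_zero (by omega),
    supportedMod_oddTheta.coeff_eq_zero (by omega)] at h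
  omega

theorem thirtyTwo_dvd_coeff_uFour_v0Even {m : ℕ} (hm : m % 4 = 3) :
    32 ∣ coeff m (uFour v0Even) := by
  obtain ⟨c, h⟩ := coeff_uFour_v0Even_eq m
  rw [(supportedMod_expandFour theta).coeff_eq_zero (by omega),
    supportedMod_oddTheta.coeff_eq_zero (by omega),
    (supportedMod_oddTheta_mul_tau_pow 1).coeff_eq_zero (by omega)] at h
  omega

theorem dvd_128_coeff_uFour_v0Even {m : ℕ} (hm : m % 8 = 5 ∨ m % 8 = 7) :
    128 ∣ coeff m (uFour v0Even) := by
  obtain ⟨c, h⟩ := coeff_uFour_v0Even_eq m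
  have h4 := four_dvd_coeff_oddTheta_mul_tau_sq (m := m) (by omega)
  rw [(supportedMod_expandFour theta).coeff_eq_zero (by omega),
    supportedMod_oddTheta.coeff_eq_zero (by omega),
    (supportedMod_oddTheta_mul_tau_pow 1).coeff_eq_zero (by omega),
    (supportedMod_oddTheta_mul_tau_pow 3).coeff_eq_zero (by omega)] at h
  omega

theorem coeff_theta_eq_zero {m : ℕ} (h4 : m % 4 ≠ 0) (h8 : m % 8 ≠ 1) : coeff m theta = 0 := by
  rw [theta_eq_add, map_add, coeff_two_mul, (supportedMod_expandFour theta).coeff_eq_zero h4,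
    supportedMod_oddTheta.coeff_eq_zero h8]
  norm_num

theorem two_mul_v0 {k m : ℕ} (hm : m ≠ 0) :
    2 * v0 (2 ^ (2 * k + 2) * m) = coeff m (uFour^[k + 1] v0Even) := by
  have h : 2 ^ (2 * k + 2) * m = 4 ^ (k + 1) * m := by
    rw [show 2 * k + 2 = 2 * (k + 1) by ring, pow_mul]
    norm_num
  have h2 : 4 ^ (k + 1) * m = 2 * (2 * 4 ^ k * m) := by ring
  have h0 : 2 * 4 ^ k * m ≠ 0 := by positivity
  rw [coeff_uFour_iterate, h, h2, coeff_v0Even_two_mul, if_neg h0, sub_zero]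

/-- Congruences for `v0` at `4^{k+1} m`, when `m` is not a square for congruence reasons. -/
theorem pow_dvd_v0 {m j : ℕ} (h4 : m % 4 ≠ 0) (h8 : m % 8 ≠ 1)
    (hB : 2 ^ (j + 3) ∣ coeff m (uFour v0Even))
    (hW : ∀ s ∈ hauptRing, 2 ^ j ∣ coeff m (theta * hauptW * s)) (k : ℕ) :
    2 ^ (3 * k + j + 2) ∣ v0 (2 ^ (2 * k + 2) * m) := by
  have h := two_mul_v0 (k := k) (m := m) (by rintro rfl; simp at h4)
  apply Int.dvd_of_mul_dvd_mul_left (a := 2) (by norm_num)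
  rw [h]
  -- One U₄ has no closed form φ + 64(⋯), so k = 0 rests on `hB`; from two on, φ contributes nothing
  -- at m and `hW` applies.
  rcases k with _ | k
  · rw [zero_add, Function.iterate_one]
    convert! hB using 1
    ring
  · obtain ⟨s, hs, e⟩ := uFour_iterate_v0Even k
    have hc := coeff_intCast_mul (64 * 8 ^ k) (theta * hauptW * s) m
    push_cast at hc
    rw [show k + 1 + 1 = k + 2 by ring, e, map_add, coeff_theta_eq_zero h4 h8, zero_add, hc]
    have e2 : (2 : ℤ) * 2 ^ (3 * (k + 1) + j + 2) = 64 * 8 ^ k * 2 ^ j := by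
      rw [show (8 : ℤ) = 2 ^ 3 by norm_num, ← pow_mul]
      ring
    rw [e2]
    exact mul_dvd_mul_left _ (hW s hs)

theorem mainTheorem3 (n α : ℕ) :
    v0 (2 ^ (2 * α + 1) * (2 * n + 1)) ≡ 0 [ZMOD 2 ^ (3 * α)] ∧
    v0 (2 ^ (2 * α + 2) * (4 * n + 3)) ≡ 0 [ZMOD 2 ^ (3 * α + 4)] ∧
    v0 (2 ^ (2 * α + 2) * (8 * n + 7)) ≡ 0 [ZMOD 2 ^ (3 * α + 6)] ∧
    v0 (2 ^ (2 * α + 2) * (8 * n + 5)) ≡ 0 [ZMOD 2 ^ (3 * α + 6)] := by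
  simp only [Int.modEq_zero_iff_dvd]
  refine ⟨?_, ?_, ?_, ?_⟩
  -- For α = 0 the modulus is 1. Otherwise one factor 2 moves into m = 4n + 2, and 3k + 1 + 2 = 3(k
  -- + 1).
  · rcases α with _ | k
    · simp
    · have e : 2 ^ (2 * (k + 1) + 1) * (2 * n + 1) = 2 ^ (2 * k + 2) * (4 * n + 2) := by ring
      rw [e]
      exact pow_dvd_v0 (j := 1) (by omega) (by omega)
        (sixteen_dvd_coeff_uFour_v0Even (by omega))
        (fun s hs => two_dvd_coeff_theta_mul_hauptW_mul hs (by omega)) k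
  · exact pow_dvd_v0 (j := 2) (by omega) (by omega)
      (thirtyTwo_dvd_coeff_uFour_v0Even (by omega))
      (fun s hs => four_dvd_coeff_theta_mul_hauptW_mul hs (by omega)) α
  · exact pow_dvd_v0 (j := 4) (by omega) (by omega)
      (dvd_128_coeff_uFour_v0Even (by omega))
      (fun s hs => sixteen_dvd_coeff_theta_mul_hauptW_mul hs (by omega)) α
  · exact pow_dvd_v0 (j := 4) (by omega) (by omega)
      (dvd_128_coeff_uFour_v0Even (by omega))
      (fun s hs => sixteen_dvd_coeff_theta_mul_hauptW_mul hs (by omega)) α
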